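/- Let $p\ge 2$, $n\ge 1$ and $\lambda>0$, and let $X_1,\dots,X_n$ be a sample of points of the unit sphere $\mathcal S^{p-1}\subset\mathbb R^p$. Let $\nu_{p-1}$ be the uniform probability measure on $\mathcal S^{p-1}$, let $\Delta_{\mathcal S^{p-1}}$ be the Laplace--Beltrami operator of $\mathcal S^{p-1}$, applied to functions of $x$, and let $$T_n(\lambda):=n\int_{\mathcal S^{p-1}}\Big(\frac1n\sum_{j=1}^n \Delta_{\mathcal S^{p-1}}e^{\lambda t^\top x}\big|_{x=X_j}\Big)^2\,d\nu_{p-1}(t).$$ For $p\ge3$ let $C_k^{(p-2)/2}$ be the Gegenbauer polynomial of degree $k$ and index $(p-2)/2$, and for $p=2$ let $C_k^{0}(u):=\cos(k\arccos u)$, $u\in[-1,1]$. Let $\langle f,g\rangle_p:=\int_{-1}^1 f(u)g(u)(1-u^2)^{(p-3)/2}\,du$, and for $k\ge 1$ $$m_{k,p}(\lambda):=\frac{\langle e^{\lambda\,\cdot},C_k^{(p-2)/2}\rangle_p}{\langle C_k^{(p-2)/2},C_k^{(p-2)/2}\rangle_p},\qquad \gamma_{k,p}:=\begin{cases}\tfrac12,&p=2,\\[2pt]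 \frac{p-2}{2k+p-2},&p>2,\end{cases}\qquad c_{k,p}(\lambda):=\big(m_{k,p}(\lambda)\,k(k+p-2)\big)^2\gamma_{k,p}.$$ Then the function of $t$ in parentheses in the definition of $T_n(\lambda)$ belongs to $L^2(\mathcal S^{p-1},\nu_{p-1})$, the series below converge absolutely, and $$T_n(\lambda)=\frac1n\sum_{i,j=1}^n\sum_{k=1}^\infty c_{k,p}(\lambda)\,C_k^{(p-2)/2}(X_i^\top X_j).$$ Moreover, with $I_\alpha$ the modified Bessel function of the first kind of order $\alpha$, for all $k\ge1$, $$c_{k,p}(\lambda)=\begin{cases}2k^4I_k(\lambda)^2,&p=2,\\[4pt] 2^{p-3}\lambda^{2-p}(p-2)\Big(k+\frac{p-2}2\Big)\Big(\Gamma\big(\tfrac{p-2}2\big)\,k(k+p-2)\,I_{(p-2)/2+k}(\lambda)\Big)^2,&p>2.\end{cases}$$ -/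

import Mathlib

noncomputable section

open MeasureTheory Metric

/-- The unit sphere `S^{p-1}` of the Euclidean space `ℝ^p`. -/
abbrev UnitSphere (p : ℕ) : Type := sphere (0 : EuclideanSpace ℝ (Fin p)) 1

/-- The uniform probability measure on `S^{p-1}`: the normalized surface measure. -/
def uniformSphere (p : ℕ) : Measure (UnitSphere p) :=
  ((volume : Measure (EuclideanSpace ℝ (Fin p))).toSphere Set.univ)⁻¹ •
    (volume : Measure (EuclideanSpace ℝ (Fin p))).toSphere

/-- The extension of a function on the sphere to `ℝ^p` that is constant along the open rays from
the origin, `y ↦ f (y / ‖y‖)`; the value at the origin plays no role. -/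
def radialExtension {p : ℕ} (f : UnitSphere p → ℝ) (y : EuclideanSpace ℝ (Fin p)) : ℝ :=
  if hy : y = 0 then 0
  else f ⟨‖y‖⁻¹ • y, by simp [norm_smul, hy]⟩

/-- The Laplace--Beltrami operator of `S^{p-1}`, as the spherical part of the Euclidean Laplacian:
`(Δ_S f)(x) = Δ (y ↦ f (y / ‖y‖)) (x)` for `x ∈ S^{p-1}`. -/
def laplaceBeltrami {p : ℕ} (f : UnitSphere p → ℝ) (x : UnitSphere p) : ℝ :=
  Laplacian.laplacian (radialExtension f) (x : EuclideanSpace ℝ (Fin p))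

/-- `Δ_S exp (lam tᵀx)`: the Laplace--Beltrami operator acts on the variable `x`. -/
def steinExp {p : ℕ} (lam : ℝ) (t x : UnitSphere p) : ℝ :=
  laplaceBeltrami (fun y : UnitSphere p =>
    Real.exp (lam * inner ℝ (t : EuclideanSpace ℝ (Fin p)) (y : EuclideanSpace ℝ (Fin p)))) x

/-- The empirical mean `(1/n) ∑ⱼ Δ_S exp (lam tᵀXⱼ)`, as a function of `t`. -/
def empiricalStein {p n : ℕ} (lam : ℝ) (X : Fin n → UnitSphere p) (t : UnitSphere p) : ℝ :=
  (1 / (n : ℝ)) * ∑ j, steinExp lam t (X j)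

/-- The test statistic `T_n(lam) = n ‖(1/n) ∑ⱼ Δ_S exp (lam tᵀXⱼ)‖²`, with the norm of
`L²(S^{p-1})` in the variable `t`, for the uniform probability measure. -/
def testStatistic {p n : ℕ} (lam : ℝ) (X : Fin n → UnitSphere p) : ℝ :=
  (n : ℝ) * ∫ t, (empiricalStein lam X t) ^ 2 ∂(uniformSphere p)

/-- The classical Gegenbauer polynomial of degree `k` and index `a ≠ 0`, by its three-term
recurrence `k C_k(u) = 2 (k + a - 1) u C_{k-1}(u) - (k + 2 a - 2) C_{k-2}(u)`. -/
def gegenbauerRec (a : ℝ) : ℕ → ℝ → ℝ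
  | 0, _ => 1
  | 1, u => 2 * a * u
  | (k + 2), u =>
      (2 * ((k : ℝ) + 1 + a) * u * gegenbauerRec a (k + 1) u
        - ((k : ℝ) + 2 * a) * gegenbauerRec a k u) / ((k : ℝ) + 2)

open Classical in
/-- `C_k^a(u)`: the Gegenbauer polynomial for `a ≠ 0`, and the Chebyshev polynomial
`cos (k arccos u)`, `u ∈ [-1, 1]`, for `a = 0`. -/
def gegenbauer (a : ℝ) (k : ℕ) (u : ℝ) : ℝ :=
  if a = 0 then Real.cos ((k : ℝ) * Real.arccos u) else gegenbauerRec a k u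

/-- The inner product `∫_{-1}^1 f(u) g(u) (1 - u²)^{(p-3)/2} du`. -/
def weightedInner (p : ℕ) (f g : ℝ → ℝ) : ℝ :=
  ∫ u in (-1 : ℝ)..1, f u * g u * (1 - u ^ 2) ^ (((p : ℝ) - 3) / 2)

/-- The Gegenbauer coefficient `m_{k,p}(lam)` of `u ↦ exp (lam u)`. -/
def gegenbauerCoeff (p : ℕ) (lam : ℝ) (k : ℕ) : ℝ :=
  weightedInner p (fun u => Real.exp (lam * u)) (gegenbauer (((p : ℝ) - 2) / 2) k) /
    weightedInner p (gegenbauer (((p : ℝ) - 2) / 2) k) (gegenbauer (((p : ℝ) - 2) / 2) k)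

/-- The constant `γ_{k,p}`. -/
def gammaConst (p k : ℕ) : ℝ :=
  if p = 2 then (1 + (if k = 0 then 1 else 0)) / 2
  else ((p : ℝ) - 2) / (2 * (k : ℝ) + (p : ℝ) - 2)

/-- The weight `c_{k,p}(lam) = (m_{k,p}(lam) k (k + p - 2))² γ_{k,p}`. -/
def weight (p : ℕ) (lam : ℝ) (k : ℕ) : ℝ :=
  (gegenbauerCoeff p lam k * (k : ℝ) * ((k : ℝ) + (p : ℝ) - 2)) ^ 2 * gammaConst p k

/-- The modified Bessel function of the first kind `I_a(x)`, for `a ≥ 0` and `x > 0`. -/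
def besselI (a x : ℝ) : ℝ :=
  ∑' m : ℕ, (x / 2) ^ (2 * (m : ℝ) + a) / ((m.factorial : ℝ) * Real.Gamma ((m : ℝ) + a + 1))

end

open MeasureTheory Metric
open scoped Polynomial

/-! With `a = (p - 2) / 2`, the spherical Laplacian of `exp (lam tᵀx)` depends only on `u = tᵀx`: it
is `steinProfile`, the Gegenbauer operator applied to `exp (lam u)`. So `T_n` is a double sum of
integrals of products of two zonal functions with poles `X i`, `X j`, and everything reduces to
harmonic analysis of zonal functions.

The Gegenbauer polynomials are rescaled to the reproducing kernels `zonalPoly a k`, whose recurrence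
has no singularity at `a = 0`, so that `p = 2` and `p > 2` are treated together. Three facts carry
the proof. These polynomials are eigenfunctions of the Gegenbauer operator with eigenvalue `-k (k +
2 a)` (`gegenbauerOp_zonalPoly`). Under integration over the sphere, different degrees are
orthogonal even for different poles, and equal degrees reproduce the kernel
(`zonalForm_zonalPoly_of_ne`, `zonalForm_zonalPoly_self`). Finally, `u ^ n` has explicit nonnegative
coefficients in this basis (`powCoeff_add_two_mul`), so the exponential has coefficients `expCoeff`,
which are Bessel series (`expCoeff_eq_besselI`).

Hence `∫ h(tᵀx) h(tᵀy) dν(t)` is the sum of `(expCoeff * k (k + 2 a)) ^ 2 * zonalPoly`. No theory of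
spherical harmonics is needed: the mixed moments of two coordinates on the sphere satisfy a
recurrence, obtained from Gaussian integration by parts, which yields symmetry of the operator and
hence orthogonality. The ultraspherical weight satisfies the same recurrence, which identifies
`gegenbauerCoeff` with `expCoeff` divided by `gammaConst`. -/

/-- The coefficient `k / (2 (k + a))` of the three-term recurrence of `zonalPoly`. -/
noncomputable def zonalStep (a : ℝ) (k : ℕ) : ℝ := k / (2 * (k + a))

/-- The zonal polynomial of degree `k`: the multiple of the Gegenbauer polynomial of index `a` that
is the reproducing kernel of the spherical harmonics of degree `k` on the sphere of dimension
`2 a + 1`. -/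
noncomputable def zonalPoly (a : ℝ) : ℕ → ℝ[X]
  | 0 => 1
  | 1 => Polynomial.C (2 * (1 + a)) * Polynomial.X
  | (k + 2) => Polynomial.C (1 / zonalStep a (k + 2)) *
      (Polynomial.X * zonalPoly a (k + 1) - Polynomial.C (1 - zonalStep a k) * zonalPoly a k)

/-- The coefficients of `X ^ n` in the basis `zonalPoly a`. -/
noncomputable def powCoeff (a : ℝ) : ℕ → ℕ → ℝ
  | 0, 0 => 1
  | 0, _ + 1 => 0
  | n + 1, 0 => powCoeff a n 1
  | n + 1, k + 1 => zonalStep a (k + 1) * powCoeff a n k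
      + (1 - zonalStep a (k + 1)) * powCoeff a n (k + 2)

/-- The rising factorial `(a + 1) (a + 2) ⋯ (a + m)`. -/
noncomputable def risingFactorial (a : ℝ) (m : ℕ) : ℝ := ∏ i ∈ Finset.range m, (a + 1 + i)

/-- The Gegenbauer differential operator `(1 - u²) f'' - (2 a + 1) u f'`. -/
noncomputable def gegenbauerOp (a : ℝ) (f : ℝ[X]) : ℝ[X] :=
  (1 - Polynomial.X ^ 2) * Polynomial.derivative (Polynomial.derivative f)
    - Polynomial.C (2 * a + 1) * Polynomial.X * Polynomial.derivative f

/-! ### Algebra of the zonal polynomials: recurrence, expansion of powers, differential equation. -/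

section ZonalAlgebra

variable {a : ℝ}

/-- This includes `a = 0`, where the quotient is `0 / 0 = 0`; the recurrences use this value at
their boundary. -/
lemma zonalStep_zero : zonalStep a 0 = 0 := by simp [zonalStep]

lemma zonalStep_pos (ha : 0 ≤ a) (k : ℕ) : 0 < zonalStep a (k + 1) := by
  unfold zonalStep; positivity

lemma zonalStep_lt_one (ha : 0 ≤ a) (k : ℕ) : zonalStep a k < 1 := by
  rcases k with _ | k
  · simp [zonalStep]
  · unfold zonalStep
    rw [div_lt_one (by positivity)]
    push_cast
    nlinarith [(Nat.cast_nonneg k : (0 : ℝ) ≤ k)]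

lemma X_mul_zonalPoly_zero (ha : 0 ≤ a) :
    Polynomial.X * zonalPoly a 0 = Polynomial.C (zonalStep a 1) * zonalPoly a 1 := by
  have h : zonalStep a 1 * (2 * (1 + a)) = 1 := by
    unfold zonalStep; push_cast; field_simp
  rw [zonalPoly, zonalPoly, ← mul_assoc, ← Polynomial.C_mul, h]
  simp

lemma X_mul_zonalPoly_succ (ha : 0 ≤ a) (k : ℕ) :
    Polynomial.X * zonalPoly a (k + 1) = Polynomial.C (zonalStep a (k + 2)) * zonalPoly a (k + 2)
      + Polynomial.C (1 - zonalStep a k) * zonalPoly a k := by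
  have h : zonalStep a (k + 2) * (1 / zonalStep a (k + 2)) = 1 :=
    mul_one_div_cancel (zonalStep_pos ha (k + 1)).ne'
  rw [zonalPoly, ← mul_assoc, ← Polynomial.C_mul, h]
  simp

lemma powCoeff_eq_zero_of_lt {n k : ℕ} (h : n < k) : powCoeff a n k = 0 := by
  induction n generalizing k with
  | zero => obtain ⟨k, rfl⟩ := Nat.exists_eq_succ_of_ne_zero h.ne'; simp [powCoeff]
  | succ n ih =>
    obtain ⟨k, rfl⟩ := Nat.exists_eq_succ_of_ne_zero (Nat.ne_zero_of_lt h)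
    rw [Nat.succ_eq_add_one, powCoeff, ih (by omega), ih (by omega)]
    simp

lemma powCoeff_nonneg (ha : 0 ≤ a) (n k : ℕ) : 0 ≤ powCoeff a n k := by
  induction n generalizing k with
  | zero => rcases k with _ | k <;> simp [powCoeff]
  | succ n ih =>
    rcases k with _ | k
    · exact ih 1
    · have h1 := zonalStep_pos ha k
      have h2 := zonalStep_lt_one ha (k + 1)
      rw [powCoeff]
      exact add_nonneg (mul_nonneg h1.le (ih k)) (mul_nonneg (by linarith) (ih _))

/-- The recursion of `powCoeff` is the transpose of the three-term recurrence: it records how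
multiplication by `X` moves the weight of degree `k` to the degrees `k + 1` and `k - 1`. -/
lemma X_pow_eq_sum_zonalPoly (ha : 0 ≤ a) (n : ℕ) :
    (Polynomial.X : ℝ[X]) ^ n =
      ∑ k ∈ Finset.range (n + 1), Polynomial.C (powCoeff a n k) * zonalPoly a k := by
  induction n with
  | zero => simp [powCoeff, zonalPoly]
  | succ n ih =>
    have hb : ∀ k, Polynomial.C (powCoeff a (n + 1) (k + 1)) * zonalPoly a (k + 1) =
        Polynomial.C (zonalStep a (k + 1) * powCoeff a n k) * zonalPoly a (k + 1) +
        Polynomial.C ((1 - zonalStep a (k + 1)) * powCoeff a n (k + 2)) * zonalPoly a (k + 1) := by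
      intro k
      rw [powCoeff, Polynomial.C_add, add_mul]
    have hR : ∑ k ∈ Finset.range (n + 1 + 1), Polynomial.C (powCoeff a (n + 1) k) * zonalPoly a k
        = ∑ k ∈ Finset.range (n + 1),
            Polynomial.C (zonalStep a (k + 1) * powCoeff a n k) * zonalPoly a (k + 1)
          + ∑ k ∈ Finset.range (n + 2),
            Polynomial.C ((1 - zonalStep a k) * powCoeff a n (k + 1)) * zonalPoly a k := by
      rw [Finset.sum_range_succ', Finset.sum_congr rfl fun k _ => hb k, Finset.sum_add_distrib,
        Finset.sum_range_succ' _ (n + 1), zonalStep_zero]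
      simp [powCoeff, add_assoc]
    -- The two extra terms carry `powCoeff a n (n + 1)` and `powCoeff a n (n + 2)`, both zero.
    have hT : ∑ k ∈ Finset.range (n + 2),
            Polynomial.C ((1 - zonalStep a k) * powCoeff a n (k + 1)) * zonalPoly a k
        = ∑ k ∈ Finset.range n,
            Polynomial.C ((1 - zonalStep a k) * powCoeff a n (k + 1)) * zonalPoly a k := by
      rw [Finset.sum_range_succ, Finset.sum_range_succ, powCoeff_eq_zero_of_lt (by omega),
        powCoeff_eq_zero_of_lt (by omega)]
      simp
    rw [hR, hT, pow_succ', ih, Finset.mul_sum, Finset.sum_range_succ', Finset.sum_range_succ']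
    have h0 : Polynomial.X * (Polynomial.C (powCoeff a n 0) * zonalPoly a 0)
        = Polynomial.C (zonalStep a (0 + 1) * powCoeff a n 0) * zonalPoly a (0 + 1) := by
      rw [mul_left_comm, X_mul_zonalPoly_zero ha, Polynomial.C_mul]; ring
    have h1 : ∀ k, Polynomial.X * (Polynomial.C (powCoeff a n (k + 1)) * zonalPoly a (k + 1))
        = Polynomial.C (zonalStep a (k + 1 + 1) * powCoeff a n (k + 1)) * zonalPoly a (k + 1 + 1)
          + Polynomial.C ((1 - zonalStep a k) * powCoeff a n (k + 1)) * zonalPoly a k := by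
      intro k
      rw [mul_left_comm, X_mul_zonalPoly_succ ha, Polynomial.C_mul, Polynomial.C_mul]; ring
    rw [h0, Finset.sum_congr rfl fun k _ => h1 k, Finset.sum_add_distrib]
    ring

lemma pow_eq_sum_zonalPoly (ha : 0 ≤ a) (n : ℕ) (u : ℝ) :
    u ^ n = ∑ k ∈ Finset.range (n + 1), powCoeff a n k * (zonalPoly a k).eval u := by
  simpa [Polynomial.eval_finsetSum] using
    congrArg (Polynomial.eval u) (X_pow_eq_sum_zonalPoly ha n)

lemma risingFactorial_succ (m : ℕ) :
    risingFactorial a (m + 1) = risingFactorial a m * (a + 1 + m) :=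
  Finset.prod_range_succ _ _

lemma risingFactorial_pos (ha : 0 ≤ a) (m : ℕ) : 0 < risingFactorial a m :=
  Finset.prod_pos fun i _ => by positivity

/-- With the factor `lam ^ n / n!` this becomes, term by term, the power series of a Bessel
function; it also gives the eigenvalue identity below. -/
lemma powCoeff_add_two_mul (ha : 0 ≤ a) (k j : ℕ) :
    powCoeff a (k + 2 * j) k =
      (k + 2 * j).factorial / (2 ^ (k + 2 * j) * (j.factorial * risingFactorial a (k + j))) := by
  induction hn : k + 2 * j generalizing k j with
  | zero =>
    obtain ⟨rfl, rfl⟩ : k = 0 ∧ j = 0 := by omega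
    simp [powCoeff, risingFactorial]
  | succ n ih =>
    rcases k with _ | k
    · obtain ⟨j, rfl⟩ : ∃ i, j = i + 1 := ⟨j - 1, by omega⟩
      obtain rfl : n = 1 + 2 * j := by omega
      rw [powCoeff, ih 1 j rfl, Nat.factorial_succ (1 + 2 * j), Nat.factorial_succ j, pow_succ]
      rw [show 0 + (j + 1) = 1 + j by ring]
      have := risingFactorial_pos ha (1 + j)
      push_cast
      field_simp
      ring
    · rw [powCoeff, ih k j (by omega), Nat.factorial_succ n]
      have h1 := risingFactorial_pos ha (k + j)
      rcases j with _ | j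
      -- On the diagonal `n = k`, the contribution from degree `k + 2` vanishes.
      · rw [powCoeff_eq_zero_of_lt (by omega)]
        obtain rfl : n = k := by omega
        rw [show n + 1 + 0 = n + 0 + 1 by ring, risingFactorial_succ, pow_succ]
        simp only [add_zero] at h1 ⊢
        unfold zonalStep
        have : (0 : ℝ) < a + 1 + n := by positivity
        have : (0 : ℝ) < n + 1 + a := by positivity
        push_cast
        field_simp
        ring
      · rw [ih (k + 2) j (by omega)]
        obtain rfl : n = k + 2 * j + 2 := by omega
        rw [show k + 1 + (j + 1) = k + (j + 1) + 1 by ring, risingFactorial_succ (k + (j + 1)),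
          show k + 2 + j = k + (j + 1) + 1 by ring, risingFactorial_succ (k + (j + 1)),
          Nat.factorial_succ j, pow_succ 2 (k + 2 * j + 2)]
        unfold zonalStep
        have : (0 : ℝ) < a + 1 + (k + (j + 1)) := by positivity
        have : (0 : ℝ) < k + 1 + a := by positivity
        push_cast
        field_simp
        ring

/-- Parity: multiplication by `X` changes the degree by exactly one. -/
lemma powCoeff_eq_zero {n k : ℕ} (h : ∀ j, n ≠ k + 2 * j) : powCoeff a n k = 0 := by
  induction n generalizing k with
  | zero =>
    rcases k with _ | k
    · exact absurd rfl (h 0)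
    · rfl
  | succ n ih =>
    rcases k with _ | k
    · rw [powCoeff, ih]
      intro j hj
      exact h (j + 1) (by omega)
    · rw [powCoeff, ih, ih]
      · simp
      · intro j hj
        exact h (j + 1) (by omega)
      · intro j hj
        exact h j (by omega)

lemma powCoeff_self_pos (ha : 0 ≤ a) (n : ℕ) : 0 < powCoeff a n n := by
  have h := powCoeff_add_two_mul ha n 0
  simp only [mul_zero, add_zero] at h
  rw [h]
  have := risingFactorial_pos ha n
  positivity

/-- This is what termwise application of the operator to the expansion of `X ^ (n + 2)` would give
if the zonal polynomials were eigenfunctions. Checking it on the closed form avoids circularity. -/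
lemma powCoeff_eigen_add_two (ha : 0 ≤ a) (n k : ℕ) :
    (((n : ℝ) + 2) * (n + 2 + 2 * a) - k * (k + 2 * a)) * powCoeff a (n + 2) k =
      (n + 2) * (n + 1) * powCoeff a n k := by
  by_cases h : ∃ j, n + 2 = k + 2 * j
  · obtain ⟨j, hj⟩ := h
    rcases j with _ | j
    · rw [powCoeff_eq_zero_of_lt (n := n) (by omega)]
      obtain rfl : k = n + 2 := by omega
      push_cast
      ring
    · obtain rfl : n = k + 2 * j := by omega
      rw [powCoeff_add_two_mul ha k j, show k + 2 * j + 2 = k + 2 * (j + 1) by ring,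
        powCoeff_add_two_mul ha k (j + 1), show k + (j + 1) = k + j + 1 by ring,
        show k + 2 * (j + 1) = k + 2 * j + 1 + 1 by ring, Nat.factorial_succ (k + 2 * j + 1),
        Nat.factorial_succ (k + 2 * j), Nat.factorial_succ j, risingFactorial_succ]
      have h1 := risingFactorial_pos ha (k + j)
      have : (0 : ℝ) < a + 1 + (k + j) := by positivity
      push_cast
      field_simp
      ring
  · push Not at h
    rw [powCoeff_eq_zero h, powCoeff_eq_zero]
    · simp
    · intro j hj
      exact h (j + 1) (by omega)

lemma gegenbauerOp_add (f g : ℝ[X]) :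
    gegenbauerOp a (f + g) = gegenbauerOp a f + gegenbauerOp a g := by
  simp only [gegenbauerOp, Polynomial.derivative_add]; ring

lemma gegenbauerOp_C_mul (c : ℝ) (f : ℝ[X]) :
    gegenbauerOp a (Polynomial.C c * f) = Polynomial.C c * gegenbauerOp a f := by
  simp only [gegenbauerOp, Polynomial.derivative_C_mul]; ring

lemma gegenbauerOp_sum {ι : Type*} (s : Finset ι) (f : ι → ℝ[X]) :
    gegenbauerOp a (∑ i ∈ s, f i) = ∑ i ∈ s, gegenbauerOp a (f i) := by
  simp only [gegenbauerOp, Polynomial.derivative_sum, Finset.mul_sum, Finset.sum_sub_distrib]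

lemma gegenbauerOp_X_pow (n : ℕ) :
    gegenbauerOp a (Polynomial.X ^ n) = Polynomial.C ((n : ℝ) * (n - 1)) * Polynomial.X ^ (n - 2)
      - Polynomial.C ((n : ℝ) * (n + 2 * a)) * Polynomial.X ^ n := by
  rcases n with _ | _ | n
  · simp [gegenbauerOp]
  · simp [gegenbauerOp]
    ring
  · simp only [gegenbauerOp, Polynomial.derivative_X_pow, Polynomial.derivative_C_mul,
      Nat.add_sub_cancel]
    simp only [show n + 1 + 1 - 2 = n by omega]
    push_cast
    simp only [map_add, map_mul, map_sub, map_one, map_ofNat, Polynomial.C_eq_natCast]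
    ring

lemma sum_powCoeff_eigen (ha : 0 ≤ a) (n : ℕ) :
    gegenbauerOp a (Polynomial.X ^ n) = ∑ k ∈ Finset.range (n + 1),
      Polynomial.C (-((k : ℝ) * (k + 2 * a)) * powCoeff a n k) * zonalPoly a k := by
  rw [gegenbauerOp_X_pow]
  rcases n with _ | _ | n
  · simp
  · rw [X_pow_eq_sum_zonalPoly ha]
    simp [Finset.sum_range_succ, powCoeff]
    rw [mul_assoc, ← X_mul_zonalPoly_zero ha]
    simp [zonalPoly]
  · rw [X_pow_eq_sum_zonalPoly ha (n + 1 + 1), X_pow_eq_sum_zonalPoly ha (n + 1 + 1 - 2),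
      Finset.mul_sum, Finset.mul_sum]
    have hT : ∑ k ∈ Finset.range (n + 1 + 1 - 2 + 1), Polynomial.C (((n + 1 + 1 : ℕ) : ℝ) *
          (((n + 1 + 1 : ℕ) : ℝ) - 1)) *
          (Polynomial.C (powCoeff a (n + 1 + 1 - 2) k) * zonalPoly a k)
        = ∑ k ∈ Finset.range (n + 1 + 1 + 1), Polynomial.C (((n + 1 + 1 : ℕ) : ℝ) *
          (((n + 1 + 1 : ℕ) : ℝ) - 1)) * (Polynomial.C (powCoeff a n k) * zonalPoly a k) := by
      rw [Finset.sum_range_succ _ (n + 1 + 1), Finset.sum_range_succ _ (n + 1),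
        powCoeff_eq_zero_of_lt (by omega), powCoeff_eq_zero_of_lt (by omega)]
      simp
    rw [hT, ← Finset.sum_sub_distrib]
    refine Finset.sum_congr rfl fun k _ => ?_
    rw [← mul_assoc, ← mul_assoc, ← Polynomial.C_mul, ← Polynomial.C_mul, ← sub_mul,
      ← Polynomial.C_sub]
    congr 2
    have h := powCoeff_eigen_add_two ha n k
    push_cast
    rw [show n + 2 = n + 1 + 1 by ring] at h
    linear_combination -h

/-- The zonal polynomials solve the Gegenbauer differential equation. -/
lemma gegenbauerOp_zonalPoly (ha : 0 ≤ a) (n : ℕ) :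
    gegenbauerOp a (zonalPoly a n) =
      Polynomial.C (-((n : ℝ) * (n + 2 * a))) * zonalPoly a n := by
  induction n using Nat.strong_induction_on with
  | _ n ih =>
    have h := sum_powCoeff_eigen ha n
    rw [X_pow_eq_sum_zonalPoly ha n, gegenbauerOp_sum, Finset.sum_range_succ,
      Finset.sum_range_succ] at h
    -- By induction all terms of index below `n` agree on both sides; the top term remains, with the
    -- nonzero coefficient `powCoeff a n n`.
    have h' : ∀ k ∈ Finset.range n, gegenbauerOp a (Polynomial.C (powCoeff a n k) * zonalPoly a k)
        = Polynomial.C (-((k : ℝ) * (k + 2 * a)) * powCoeff a n k) * zonalPoly a k := by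
      intro k hk
      rw [gegenbauerOp_C_mul, ih k (Finset.mem_range.1 hk), Polynomial.C_mul]
      ring
    rw [Finset.sum_congr rfl h', add_right_inj, gegenbauerOp_C_mul, mul_comm (-_ : ℝ),
      Polynomial.C_mul, mul_assoc] at h
    exact mul_left_cancel₀ (Polynomial.C_ne_zero.2 (powCoeff_self_pos ha n).ne') h

/-- At `u = 1` the coefficients `zonalStep a k` and `1 - zonalStep a k` sum to one, so the
three-term recurrence telescopes to two terms. The squared norms will satisfy the same relation. -/
lemma zonalStep_mul_zonalPoly_eval_one (ha : 0 ≤ a) (k : ℕ) :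
    zonalStep a (k + 1) * (zonalPoly a (k + 1)).eval 1 =
      (1 - zonalStep a k) * (zonalPoly a k).eval 1 := by
  induction k with
  | zero =>
    have h := congrArg (Polynomial.eval 1) (X_mul_zonalPoly_zero ha)
    simp only [Polynomial.eval_mul, Polynomial.eval_X, Polynomial.eval_C] at h
    rw [zonalStep_zero]
    linarith
  | succ k ih =>
    have h := congrArg (Polynomial.eval 1) (X_mul_zonalPoly_succ ha k)
    simp only [Polynomial.eval_mul, Polynomial.eval_X, Polynomial.eval_C, Polynomial.eval_add] at h
    linarith

lemma zonalPoly_eval_one_pos (ha : 0 ≤ a) (k : ℕ) : 0 < (zonalPoly a k).eval 1 := by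
  induction k with
  | zero => simp [zonalPoly]
  | succ k ih =>
    have h := zonalStep_mul_zonalPoly_eval_one ha k
    have h1 : 0 < zonalStep a (k + 1) * (zonalPoly a (k + 1)).eval 1 := by
      rw [h]
      exact mul_pos (by linarith [zonalStep_lt_one ha k]) ih
    exact (mul_pos_iff_of_pos_left (zonalStep_pos ha k)).1 h1

/-- Every polynomial is a combination of zonal polynomials. -/
lemma exists_eq_sum_zonalPoly (ha : 0 ≤ a) (f : ℝ[X]) :
    ∃ (n : ℕ) (c : ℕ → ℝ), f = ∑ k ∈ Finset.range n, Polynomial.C (c k) * zonalPoly a k := by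
  refine ⟨f.natDegree + 1, fun k => ∑ m ∈ Finset.range (f.natDegree + 1),
    f.coeff m * powCoeff a m k, ?_⟩
  conv_lhs => rw [f.as_sum_range_C_mul_X_pow]
  have : ∀ m ∈ Finset.range (f.natDegree + 1), Polynomial.C (f.coeff m) * Polynomial.X ^ m =
      ∑ k ∈ Finset.range (f.natDegree + 1),
        Polynomial.C (f.coeff m * powCoeff a m k) * zonalPoly a k := by
    intro m hm
    rw [X_pow_eq_sum_zonalPoly ha m, Finset.mul_sum]
    rw [Finset.sum_subset (Finset.range_mono (Nat.succ_le_of_lt (Finset.mem_range.1 hm)))]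
    · simp [mul_assoc]
    · intro k _ hk
      rw [powCoeff_eq_zero_of_lt (by simpa using hk)]
      simp
  rw [Finset.sum_congr rfl this, Finset.sum_comm]
  simp [Finset.sum_mul]

end ZonalAlgebra

/-! ### Mixed moments of two coordinates on the sphere, through Gaussian integrals. -/

section SphereMoments

variable {p : ℕ}

lemma integrable_norm_pow_mul_exp_neg_norm_sq [NeZero p] (n : ℕ) :
    Integrable fun v : EuclideanSpace ℝ (Fin p) => ‖v‖ ^ n * Real.exp (-‖v‖ ^ 2) := by
  refine (integrable_fun_norm_addHaar (volume : Measure (EuclideanSpace ℝ (Fin p)))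
    (f := fun r => r ^ n * Real.exp (-r ^ 2))).2 ?_
  have h := integrableOn_rpow_mul_exp_neg_mul_sq (b := 1) one_pos
    (s := ((Module.finrank ℝ (EuclideanSpace ℝ (Fin p)) - 1 + n : ℕ) : ℝ))
    (lt_of_lt_of_le neg_one_lt_zero (Nat.cast_nonneg _))
  refine h.congr_fun (fun r _ => ?_) measurableSet_Ioi
  simp only [Real.rpow_natCast, smul_eq_mul, pow_add, neg_one_mul]
  ring

lemma abs_inner_sphere_le (v : EuclideanSpace ℝ (Fin p)) (x : UnitSphere p) :
    |inner ℝ v (x : EuclideanSpace ℝ (Fin p))| ≤ ‖v‖ := by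
  simpa using abs_real_inner_le_norm v (x : EuclideanSpace ℝ (Fin p))

lemma integrable_inner_pow_mul_exp_neg_norm_sq [NeZero p] (x y : UnitSphere p) (i j : ℕ) :
    Integrable fun v : EuclideanSpace ℝ (Fin p) =>
      inner ℝ v (x : EuclideanSpace ℝ (Fin p)) ^ i *
        inner ℝ v (y : EuclideanSpace ℝ (Fin p)) ^ j * Real.exp (-‖v‖ ^ 2) := by
  refine (integrable_norm_pow_mul_exp_neg_norm_sq (p := p) (i + j)).mono'
    (by fun_prop) (.of_forall fun v => ?_)
  rw [norm_mul, norm_mul, norm_pow, norm_pow, Real.norm_eq_abs, Real.norm_eq_abs,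
    Real.norm_eq_abs, Real.abs_exp, pow_add]
  gcongr
  · exact abs_inner_sphere_le v x
  · exact abs_inner_sphere_le v y

/-- Gaussian integration by parts in the direction `x`. -/
lemma integral_inner_pow_succ_mul_exp_neg_norm_sq [NeZero p] (x y : UnitSphere p) (i j : ℕ) :
    2 * ∫ v : EuclideanSpace ℝ (Fin p), inner ℝ v (x : EuclideanSpace ℝ (Fin p)) ^ (i + 1) *
        inner ℝ v (y : EuclideanSpace ℝ (Fin p)) ^ j * Real.exp (-‖v‖ ^ 2) =
    i * (∫ v : EuclideanSpace ℝ (Fin p), inner ℝ v (x : EuclideanSpace ℝ (Fin p)) ^ (i - 1) *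
        inner ℝ v (y : EuclideanSpace ℝ (Fin p)) ^ j * Real.exp (-‖v‖ ^ 2)) +
    j * inner ℝ (x : EuclideanSpace ℝ (Fin p)) (y : EuclideanSpace ℝ (Fin p)) *
      (∫ v : EuclideanSpace ℝ (Fin p), inner ℝ v (x : EuclideanSpace ℝ (Fin p)) ^ i *
        inner ℝ v (y : EuclideanSpace ℝ (Fin p)) ^ (j - 1) * Real.exp (-‖v‖ ^ 2)) := by
  set w := inner ℝ (x : EuclideanSpace ℝ (Fin p)) (y : EuclideanSpace ℝ (Fin p)) with hw
  have hxx : inner ℝ (x : EuclideanSpace ℝ (Fin p)) (x : EuclideanSpace ℝ (Fin p)) = 1 := by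
    simp
  have I1 := integrable_inner_pow_mul_exp_neg_norm_sq x y (i + 1) j
  have I2 := integrable_inner_pow_mul_exp_neg_norm_sq x y (i - 1) j
  have I3 := integrable_inner_pow_mul_exp_neg_norm_sq x y i (j - 1)
  have key := integral_bilinear_hasLineDerivAt_right_eq_neg_left_of_integrable
    (μ := (volume : Measure (EuclideanSpace ℝ (Fin p)))) (B := ContinuousLinearMap.mul ℝ ℝ)
    (v := (x : EuclideanSpace ℝ (Fin p)))
    (f := fun v => inner ℝ v (x : EuclideanSpace ℝ (Fin p)) ^ i *
        inner ℝ v (y : EuclideanSpace ℝ (Fin p)) ^ j)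
    (f' := fun v => i * inner ℝ v (x : EuclideanSpace ℝ (Fin p)) ^ (i - 1) *
        inner ℝ v (y : EuclideanSpace ℝ (Fin p)) ^ j +
        inner ℝ v (x : EuclideanSpace ℝ (Fin p)) ^ i *
        (j * inner ℝ v (y : EuclideanSpace ℝ (Fin p)) ^ (j - 1) * w))
    (g := fun v => Real.exp (-‖v‖ ^ 2))
    (g' := fun v => Real.exp (-‖v‖ ^ 2) * (-(2 * inner ℝ v (x : EuclideanSpace ℝ (Fin p)))))
    ?_ ?_ ?_ ?_ ?_
  · simp only [ContinuousLinearMap.mul_apply'] at key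
    have e1 : ∀ v : EuclideanSpace ℝ (Fin p), inner ℝ v (x : EuclideanSpace ℝ (Fin p)) ^ i *
        inner ℝ v (y : EuclideanSpace ℝ (Fin p)) ^ j *
        (Real.exp (-‖v‖ ^ 2) * (-(2 * inner ℝ v (x : EuclideanSpace ℝ (Fin p))))) =
        -2 * (inner ℝ v (x : EuclideanSpace ℝ (Fin p)) ^ (i + 1) *
        inner ℝ v (y : EuclideanSpace ℝ (Fin p)) ^ j * Real.exp (-‖v‖ ^ 2)) := fun v => by ring
    have e2 : ∀ v : EuclideanSpace ℝ (Fin p),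
        (i * inner ℝ v (x : EuclideanSpace ℝ (Fin p)) ^ (i - 1) *
        inner ℝ v (y : EuclideanSpace ℝ (Fin p)) ^ j +
        inner ℝ v (x : EuclideanSpace ℝ (Fin p)) ^ i *
        (j * inner ℝ v (y : EuclideanSpace ℝ (Fin p)) ^ (j - 1) * w)) * Real.exp (-‖v‖ ^ 2) =
        i * (inner ℝ v (x : EuclideanSpace ℝ (Fin p)) ^ (i - 1) *
        inner ℝ v (y : EuclideanSpace ℝ (Fin p)) ^ j * Real.exp (-‖v‖ ^ 2)) +
        j * w * (inner ℝ v (x : EuclideanSpace ℝ (Fin p)) ^ i *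
        inner ℝ v (y : EuclideanSpace ℝ (Fin p)) ^ (j - 1) * Real.exp (-‖v‖ ^ 2)) :=
      fun v => by ring
    simp only [e1, e2] at key
    rw [integral_const_mul, integral_add (I2.const_mul _) (I3.const_mul _), integral_const_mul,
      integral_const_mul] at key
    linarith
  · refine ((I2.const_mul i).add (I3.const_mul (j * w))).congr (.of_forall fun v => ?_)
    simp only [ContinuousLinearMap.mul_apply', Pi.add_apply]
    ring
  · refine (I1.const_mul (-2)).congr (.of_forall fun v => ?_)
    simp only [ContinuousLinearMap.mul_apply']
    ring
  · exact integrable_inner_pow_mul_exp_neg_norm_sq x y i j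
  · intro v _
    have h1 : HasDerivAt (fun s : ℝ => inner ℝ (v + s • (x : EuclideanSpace ℝ (Fin p)))
        (x : EuclideanSpace ℝ (Fin p))) 1 0 := by
      simp only [inner_add_left, real_inner_smul_left, hxx, mul_one]
      exact (hasDerivAt_id' (0 : ℝ)).const_add (inner ℝ v (x : EuclideanSpace ℝ (Fin p)))
    have h2 : HasDerivAt (fun s : ℝ => inner ℝ (v + s • (x : EuclideanSpace ℝ (Fin p)))
        (y : EuclideanSpace ℝ (Fin p))) w 0 := by
      simp only [inner_add_left, real_inner_smul_left, ← hw]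
      simpa using ((hasDerivAt_id' (0 : ℝ)).mul_const w).const_add
        (inner ℝ v (y : EuclideanSpace ℝ (Fin p)))
    have := (h1.fun_pow i).fun_mul (h2.fun_pow j)
    simpa [HasLineDerivAt] using this
  · intro v _
    have h1 : HasDerivAt (fun s : ℝ => -‖v + s • (x : EuclideanSpace ℝ (Fin p))‖ ^ 2)
        (-(2 * inner ℝ v (x : EuclideanSpace ℝ (Fin p)))) 0 := by
      have e : ∀ s : ℝ, -‖v + s • (x : EuclideanSpace ℝ (Fin p))‖ ^ 2 =
          -(‖v‖ ^ 2 + s * (2 * inner ℝ v (x : EuclideanSpace ℝ (Fin p))) + s ^ 2) := by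
        intro s
        rw [norm_add_sq_real, norm_smul, real_inner_smul_right]
        simp
        ring
      simp only [e]
      have h := ((((hasDerivAt_id (0 : ℝ)).mul_const
        (2 * inner ℝ v (x : EuclideanSpace ℝ (Fin p)))).const_add (‖v‖ ^ 2)).add
        ((hasDerivAt_id (0 : ℝ)).pow 2)).neg
      refine h.congr_deriv ?_
      simp
    simpa [HasLineDerivAt] using h1.exp

lemma integral_volumeIoiPow_pow_mul_exp_neg_sq [NeZero p] (n : ℕ) :
    ∫ r : Set.Ioi (0 : ℝ), (r : ℝ) ^ n * Real.exp (-(r : ℝ) ^ 2) ∂(Measure.volumeIoiPow (p - 1)) =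
      Real.Gamma (((n : ℝ) + p) / 2) / 2 := by
  have h := integral_rpow_mul_exp_neg_rpow (p := 2) (q := ((p - 1 + n : ℕ) : ℝ)) two_pos
    (lt_of_lt_of_le neg_one_lt_zero (Nat.cast_nonneg _))
  have hp : 1 ≤ p := NeZero.one_le
  rw [show (((p - 1 + n : ℕ) : ℝ) + 1) / 2 = ((n : ℝ) + p) / 2 by
    push_cast [Nat.cast_sub hp]; ring] at h
  rw [show Real.Gamma (((n : ℝ) + p) / 2) / 2 = 1 / 2 * Real.Gamma (((n : ℝ) + p) / 2) by ring,
    ← h]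
  simp only [Measure.volumeIoiPow, ENNReal.ofReal]
  rw [integral_withDensity_eq_integral_smul ((measurable_subtype_coe.pow_const _).real_toNNReal),
    integral_subtype_comap measurableSet_Ioi
      fun r => Real.toNNReal (r ^ (p - 1)) • (r ^ n * Real.exp (-r ^ 2))]
  refine setIntegral_congr_fun measurableSet_Ioi fun r hr => ?_
  simp only [NNReal.smul_def, Real.coe_toNNReal _ (pow_nonneg (Set.mem_Ioi.1 hr).le _),
    Real.rpow_natCast, smul_eq_mul, pow_add, Real.rpow_ofNat]
  ring

/-- Polar coordinates for a Gaussian moment. -/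
lemma integral_inner_pow_mul_exp_neg_norm_sq_eq [NeZero p] (x y : UnitSphere p) (i j : ℕ) :
    ∫ v : EuclideanSpace ℝ (Fin p), inner ℝ v (x : EuclideanSpace ℝ (Fin p)) ^ i *
        inner ℝ v (y : EuclideanSpace ℝ (Fin p)) ^ j * Real.exp (-‖v‖ ^ 2) =
    (∫ t : UnitSphere p, inner ℝ (t : EuclideanSpace ℝ (Fin p)) (x : EuclideanSpace ℝ (Fin p)) ^ i *
        inner ℝ (t : EuclideanSpace ℝ (Fin p)) (y : EuclideanSpace ℝ (Fin p)) ^ j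
        ∂(volume : Measure (EuclideanSpace ℝ (Fin p))).toSphere) *
      (Real.Gamma ((((i + j : ℕ) : ℝ) + p) / 2) / 2) := by
  set F : EuclideanSpace ℝ (Fin p) → ℝ := fun v => inner ℝ v (x : EuclideanSpace ℝ (Fin p)) ^ i *
        inner ℝ v (y : EuclideanSpace ℝ (Fin p)) ^ j * Real.exp (-‖v‖ ^ 2) with hF
  rw [← integral_volumeIoiPow_pow_mul_exp_neg_sq, ← integral_prod_mul]
  have h0 : ∫ v, F v = ∫ v : ({0}ᶜ : Set (EuclideanSpace ℝ (Fin p))), F v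
      ∂((volume : Measure (EuclideanSpace ℝ (Fin p))).comap (↑)) := by
    rw [integral_subtype_comap (measurableSet_singleton _).compl F, restrict_compl_singleton]
  rw [h0]
  have h1 := (Measure.measurePreserving_homeomorphUnitSphereProd
    (volume : Measure (EuclideanSpace ℝ (Fin p)))).integral_comp
    (Homeomorph.measurableEmbedding _)
    (fun z => F (z.2.1 • (z.1 : EuclideanSpace ℝ (Fin p))))
  rw [show Module.finrank ℝ (EuclideanSpace ℝ (Fin p)) = p by simp] at h1
  have h2 : ∀ v : ({0}ᶜ : Set (EuclideanSpace ℝ (Fin p))),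
      F ((homeomorphUnitSphereProd (EuclideanSpace ℝ (Fin p)) v).2.1 •
        ((homeomorphUnitSphereProd (EuclideanSpace ℝ (Fin p)) v).1 :
          EuclideanSpace ℝ (Fin p))) = F v := by
    intro v
    have := congrArg Subtype.val
      ((homeomorphUnitSphereProd (EuclideanSpace ℝ (Fin p))).symm_apply_apply v)
    rw [homeomorphUnitSphereProd_symm_apply_coe] at this
    rw [this]
  simp only [h2] at h1
  rw [h1]
  refine integral_congr_ae (.of_forall fun z => ?_)
  have hz : 0 < (z.2 : ℝ) := z.2.2
  simp only [hF, real_inner_smul_left, norm_smul, Real.norm_of_nonneg hz.le, norm_eq_of_mem_sphere,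
    mul_one, mul_pow, pow_add]
  ring

/-- The mixed moments of two coordinates on the sphere. -/
noncomputable def sphereMoment (x y : UnitSphere p) (i j : ℕ) : ℝ :=
  ∫ t : UnitSphere p, inner ℝ (t : EuclideanSpace ℝ (Fin p)) (x : EuclideanSpace ℝ (Fin p)) ^ i *
    inner ℝ (t : EuclideanSpace ℝ (Fin p)) (y : EuclideanSpace ℝ (Fin p)) ^ j ∂(uniformSphere p)

instance isProbabilityMeasure_uniformSphere [NeZero p] :
    IsProbabilityMeasure (uniformSphere p) := by
  constructor
  have h : (volume : Measure (EuclideanSpace ℝ (Fin p))).toSphere ≠ 0 := by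
    rw [Ne, Measure.toSphere_eq_zero_iff_finrank]
    simpa using NeZero.ne p
  rw [uniformSphere, Measure.smul_apply, smul_eq_mul]
  exact ENNReal.inv_mul_cancel (Measure.measure_univ_ne_zero.2 h) (measure_ne_top _ _)

lemma sphereMoment_comm (x y : UnitSphere p) (i j : ℕ) :
    sphereMoment x y i j = sphereMoment y x j i := by
  simp only [sphereMoment, mul_comm]

lemma integral_inner_pow_mul_exp_neg_norm_sq_eq_sphereMoment [NeZero p] (x y : UnitSphere p)
    (i j : ℕ) :
    ((volume : Measure (EuclideanSpace ℝ (Fin p))).toSphere Set.univ)⁻¹.toReal *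
    ∫ v : EuclideanSpace ℝ (Fin p), inner ℝ v (x : EuclideanSpace ℝ (Fin p)) ^ i *
        inner ℝ v (y : EuclideanSpace ℝ (Fin p)) ^ j * Real.exp (-‖v‖ ^ 2) =
    sphereMoment x y i j * (Real.Gamma ((((i + j : ℕ) : ℝ) + p) / 2) / 2) := by
  rw [integral_inner_pow_mul_exp_neg_norm_sq_eq, sphereMoment, uniformSphere,
    integral_smul_measure, smul_eq_mul, mul_assoc]

lemma sphereMoment_zero [NeZero p] (x y : UnitSphere p) : sphereMoment x y 0 0 = 1 := by
  simp [sphereMoment]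

/-- The recurrence of the mixed moments of two coordinates on the sphere. -/
lemma sphereMoment_succ [NeZero p] (x y : UnitSphere p) (i j : ℕ) :
    ((i : ℝ) + j + p - 1) * sphereMoment x y (i + 1) j =
      i * sphereMoment x y (i - 1) j +
      j * inner ℝ (x : EuclideanSpace ℝ (Fin p)) (y : EuclideanSpace ℝ (Fin p)) *
        sphereMoment x y i (j - 1) := by
  have hp : (1 : ℝ) ≤ p := by exact_mod_cast NeZero.one_le (n := p)
  set w := inner ℝ (x : EuclideanSpace ℝ (Fin p)) (y : EuclideanSpace ℝ (Fin p)) with hw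
  have h := congrArg
    (((volume : Measure (EuclideanSpace ℝ (Fin p))).toSphere Set.univ)⁻¹.toReal * ·)
    (integral_inner_pow_succ_mul_exp_neg_norm_sq x y i j)
  rw [mul_add, mul_left_comm, mul_left_comm _ (i : ℝ), mul_left_comm _ ((j : ℝ) * _)] at h
  simp only [integral_inner_pow_mul_exp_neg_norm_sq_eq_sphereMoment, ← hw] at h
  rcases Nat.eq_zero_or_pos (i + j) with h0 | h0
  -- Here there is no degree `i + j - 1`; both terms on the right vanish, and so does the first
  -- moment.
  · obtain ⟨rfl, rfl⟩ : i = 0 ∧ j = 0 := by omega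
    have hG : 0 < Real.Gamma ((((0 + 1 + 0 : ℕ) : ℝ) + p) / 2) :=
      Real.Gamma_pos_of_pos (by positivity)
    have hM : sphereMoment x y (0 + 1) 0 = 0 := by
      simp only [Nat.cast_zero, zero_mul, add_zero] at h
      have : sphereMoment x y (0 + 1) 0 * (Real.Gamma ((((0 + 1 : ℕ) : ℝ) + p) / 2) / 2) = 0 := by
        linarith
      rcases mul_eq_zero.1 this with h | h
      · exact h
      · simp only [add_zero] at hG
        linarith
    simp [hM]
  -- The degrees `i + j + 1` and `i + j - 1` differ by two, so `Γ(s + 1) = s Γ(s)` with `2 s = i + j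
  -- + p - 1` produces the factor on the left, and the remaining radial factors cancel.
  · obtain ⟨m, hm⟩ : ∃ m, i + j = m + 1 := ⟨i + j - 1, by omega⟩
    have hs : (0 : ℝ) < ((m : ℝ) + p) / 2 := by positivity
    have hG := Real.Gamma_pos_of_pos hs
    have e1 : Real.Gamma ((((i + 1 + j : ℕ) : ℝ) + p) / 2) =
        ((m : ℝ) + p) / 2 * Real.Gamma (((m : ℝ) + p) / 2) := by
      rw [← Real.Gamma_add_one hs.ne']
      congr 1
      rw [show i + 1 + j = m + 2 by omega]
      push_cast
      ring
    have e2 : (i : ℝ) * (sphereMoment x y (i - 1) j *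
        (Real.Gamma ((((i - 1 + j : ℕ) : ℝ) + p) / 2) / 2)) =
        i * (sphereMoment x y (i - 1) j * (Real.Gamma (((m : ℝ) + p) / 2) / 2)) := by
      rcases i with _ | i
      · simp
      · rw [show i + 1 - 1 + j = m by omega]
    have e3 : (j : ℝ) * w * (sphereMoment x y i (j - 1) *
        (Real.Gamma ((((i + (j - 1) : ℕ) : ℝ) + p) / 2) / 2)) =
        j * w * (sphereMoment x y i (j - 1) * (Real.Gamma (((m : ℝ) + p) / 2) / 2)) := by
      rcases j with _ | j
      · simp
      · rw [show i + (j + 1 - 1) = m by omega]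
    rw [e1, e2, e3] at h
    have hm' : (i : ℝ) + j = m + 1 := by exact_mod_cast hm
    have h2 : (((i : ℝ) + j + p - 1) * sphereMoment x y (i + 1) j) *
        (Real.Gamma (((m : ℝ) + p) / 2) / 2) = (i * sphereMoment x y (i - 1) j +
        j * w * sphereMoment x y i (j - 1)) * (Real.Gamma (((m : ℝ) + p) / 2) / 2) := by
      rw [hm']
      linear_combination h
    exact mul_right_cancel₀ (by positivity) h2

end SphereMoments

/-! ### Orthogonality and reproducing property of zonal polynomials on the sphere. -/

section ZonalForm

variable {p : ℕ}

lemma integrable_uniformSphere_of_continuous [NeZero p] {f : UnitSphere p → ℝ}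
    (hf : Continuous f) : Integrable f (uniformSphere p) :=
  hf.integrable_of_hasCompactSupport (HasCompactSupport.of_compactSpace f)

/-- The bilinear form `∫ f(tᵀx) g(tᵀy) dν(t)` on polynomials. -/
noncomputable def zonalForm (x y : UnitSphere p) (f g : ℝ[X]) : ℝ :=
  ∫ t : UnitSphere p, f.eval (inner ℝ (t : EuclideanSpace ℝ (Fin p)) (x : EuclideanSpace ℝ (Fin p)))
    * g.eval (inner ℝ (t : EuclideanSpace ℝ (Fin p)) (y : EuclideanSpace ℝ (Fin p)))
    ∂(uniformSphere p)

lemma zonalForm_comm (x y : UnitSphere p) (f g : ℝ[X]) :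
    zonalForm x y f g = zonalForm y x g f := by
  simp only [zonalForm, mul_comm]

lemma zonalForm_C_mul_left (x y : UnitSphere p) (c : ℝ) (f g : ℝ[X]) :
    zonalForm x y (Polynomial.C c * f) g = c * zonalForm x y f g := by
  simp only [zonalForm, Polynomial.eval_mul, Polynomial.eval_C, mul_assoc, integral_const_mul]

lemma zonalForm_C_mul_right (x y : UnitSphere p) (c : ℝ) (f g : ℝ[X]) :
    zonalForm x y f (Polynomial.C c * g) = c * zonalForm x y f g := by
  rw [zonalForm_comm, zonalForm_C_mul_left, zonalForm_comm]

lemma zonalForm_X_mul (x : UnitSphere p) (f g : ℝ[X]) :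
    zonalForm x x (Polynomial.X * f) g = zonalForm x x f (Polynomial.X * g) := by
  simp only [zonalForm, Polynomial.eval_mul, Polynomial.eval_X]
  congr 1 with t
  ring

lemma zonalForm_X_pow (x y : UnitSphere p) (i j : ℕ) :
    zonalForm x y (Polynomial.X ^ i) (Polynomial.X ^ j) = sphereMoment x y i j := by
  simp [zonalForm, sphereMoment]

variable [NeZero p]

lemma integrable_zonal (x y : UnitSphere p) (f g : ℝ[X]) :
    Integrable (fun t : UnitSphere p =>
      f.eval (inner ℝ (t : EuclideanSpace ℝ (Fin p)) (x : EuclideanSpace ℝ (Fin p)))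
      * g.eval (inner ℝ (t : EuclideanSpace ℝ (Fin p)) (y : EuclideanSpace ℝ (Fin p))))
      (uniformSphere p) :=
  integrable_uniformSphere_of_continuous (by fun_prop)

lemma zonalForm_add_left (x y : UnitSphere p) (f₁ f₂ g : ℝ[X]) :
    zonalForm x y (f₁ + f₂) g = zonalForm x y f₁ g + zonalForm x y f₂ g := by
  simp only [zonalForm, Polynomial.eval_add, add_mul]
  exact integral_add (integrable_zonal x y f₁ g) (integrable_zonal x y f₂ g)

lemma zonalForm_add_right (x y : UnitSphere p) (f g₁ g₂ : ℝ[X]) :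
    zonalForm x y f (g₁ + g₂) = zonalForm x y f g₁ + zonalForm x y f g₂ := by
  rw [zonalForm_comm, zonalForm_add_left, zonalForm_comm, zonalForm_comm y]

lemma zonalForm_sub_left (x y : UnitSphere p) (f₁ f₂ g : ℝ[X]) :
    zonalForm x y (f₁ - f₂) g = zonalForm x y f₁ g - zonalForm x y f₂ g := by
  simp only [zonalForm, Polynomial.eval_sub, sub_mul]
  exact integral_sub (integrable_zonal x y f₁ g) (integrable_zonal x y f₂ g)

lemma zonalForm_sub_right (x y : UnitSphere p) (f g₁ g₂ : ℝ[X]) :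
    zonalForm x y f (g₁ - g₂) = zonalForm x y f g₁ - zonalForm x y f g₂ := by
  rw [zonalForm_comm, zonalForm_sub_left, zonalForm_comm, zonalForm_comm y]

lemma zonalForm_sum_left {ι : Type*} (x y : UnitSphere p) (s : Finset ι) (f : ι → ℝ[X])
    (g : ℝ[X]) : zonalForm x y (∑ i ∈ s, f i) g = ∑ i ∈ s, zonalForm x y (f i) g := by
  simp only [zonalForm, Polynomial.eval_finsetSum, Finset.sum_mul]
  exact integral_finsetSum _ fun i _ => integrable_zonal x y (f i) g

/-- Lowering in the direction `x` or in the direction `y` produces the same cross term `i j (xᵀy)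
M(i - 1, j - 1)`; subtracting eliminates it. This is the symmetry of the Gegenbauer operator tested
on monomials. -/
lemma sphereMoment_eigen (x y : UnitSphere p) (i j : ℕ) :
    (i : ℝ) * (i - 1) * sphereMoment x y (i - 2) j - i * (i + (p - 2)) * sphereMoment x y i j =
      j * (j - 1) * sphereMoment x y i (j - 2) - j * (j + (p - 2)) * sphereMoment x y i j := by
  have key : ∀ (x y : UnitSphere p) (i j : ℕ), (i : ℝ) * (i + j + p - 2) * sphereMoment x y i j =
      i * (i - 1) * sphereMoment x y (i - 2) j + i * j *
        inner ℝ (x : EuclideanSpace ℝ (Fin p)) (y : EuclideanSpace ℝ (Fin p)) *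
        sphereMoment x y (i - 1) (j - 1) := by
    intro x y i j
    rcases i with _ | i
    · simp
    · have h := sphereMoment_succ x y i j
      rw [show i + 1 - 2 = i - 1 by omega, Nat.add_sub_cancel]
      push_cast
      linear_combination ((i : ℝ) + 1) * h
  have h1 := key x y i j
  have h2 := key y x j i
  rw [sphereMoment_comm y x, sphereMoment_comm y x, sphereMoment_comm y x, real_inner_comm] at h2
  linear_combination h2 - h1

/-- The Gegenbauer operator is symmetric for the zonal form. -/
lemma zonalForm_gegenbauerOp {a : ℝ} (ha : a = ((p : ℝ) - 2) / 2) (x y : UnitSphere p)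
    (f g : ℝ[X]) : zonalForm x y (gegenbauerOp a f) g = zonalForm x y f (gegenbauerOp a g) := by
  induction f using Polynomial.induction_on' with
  | add f₁ f₂ h₁ h₂ => rw [gegenbauerOp_add, zonalForm_add_left, zonalForm_add_left, h₁, h₂]
  | monomial i c =>
    induction g using Polynomial.induction_on' with
    | add g₁ g₂ h₁ h₂ => rw [gegenbauerOp_add, zonalForm_add_right, zonalForm_add_right, h₁, h₂]
    | monomial j d =>
      rw [← Polynomial.C_mul_X_pow_eq_monomial, ← Polynomial.C_mul_X_pow_eq_monomial,
        gegenbauerOp_C_mul, gegenbauerOp_C_mul, zonalForm_C_mul_left, zonalForm_C_mul_left,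
        zonalForm_C_mul_right, zonalForm_C_mul_right, gegenbauerOp_X_pow, gegenbauerOp_X_pow,
        zonalForm_sub_left, zonalForm_sub_right, zonalForm_C_mul_left, zonalForm_C_mul_left,
        zonalForm_C_mul_right, zonalForm_C_mul_right]
      simp only [zonalForm_X_pow]
      have h := sphereMoment_eigen x y i j
      rw [ha]
      linear_combination c * d * h

/-- Eigenvectors of a symmetric operator: the eigenvalues differ by `(k - l) (k + l + 2 a)`, which
is nonzero. The poles `x` and `y` may be different. -/
lemma zonalForm_zonalPoly_of_ne {a : ℝ} (ha : a = ((p : ℝ) - 2) / 2) (hp : 2 ≤ p)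
    (x y : UnitSphere p) {k l : ℕ} (hkl : k ≠ l) :
    zonalForm x y (zonalPoly a k) (zonalPoly a l) = 0 := by
  have hp' : (2 : ℝ) ≤ p := by exact_mod_cast hp
  have ha0 : 0 ≤ a := by rw [ha]; linarith
  have h := zonalForm_gegenbauerOp ha x y (zonalPoly a k) (zonalPoly a l)
  rw [gegenbauerOp_zonalPoly ha0, gegenbauerOp_zonalPoly ha0, zonalForm_C_mul_left,
    zonalForm_C_mul_right] at h
  have h' : (((k : ℝ) - l) * (k + l + 2 * a)) *
      zonalForm x y (zonalPoly a k) (zonalPoly a l) = 0 := by linear_combination -h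
  refine (mul_eq_zero.1 h').resolve_left (mul_ne_zero ?_ ?_)
  · exact sub_ne_zero.2 (by exact_mod_cast hkl)
  · have : (1 : ℝ) ≤ k + l := by exact_mod_cast (show 1 ≤ k + l by omega)
    linarith

/-- Moving a factor `X` from one argument to the other, with orthogonality, gives for the squared
norms the recursion that the values at `1` satisfy; both start at `1`. -/
lemma zonalForm_zonalPoly_self_diag {a : ℝ} (ha : a = ((p : ℝ) - 2) / 2) (hp : 2 ≤ p)
    (x : UnitSphere p) (k : ℕ) :
    zonalForm x x (zonalPoly a k) (zonalPoly a k) = (zonalPoly a k).eval 1 := by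
  have hp' : (2 : ℝ) ≤ p := by exact_mod_cast hp
  have ha0 : 0 ≤ a := by rw [ha]; linarith
  have orth : ∀ k l, k ≠ l → zonalForm x x (zonalPoly a k) (zonalPoly a l) = 0 :=
    fun k l => zonalForm_zonalPoly_of_ne ha hp x x
  induction k with
  | zero => simp [zonalForm, zonalPoly]
  | succ k ih =>
    have h1 : zonalForm x x (Polynomial.X * zonalPoly a k) (zonalPoly a (k + 1)) =
        zonalStep a (k + 1) * zonalForm x x (zonalPoly a (k + 1)) (zonalPoly a (k + 1)) := by
      rcases k with _ | k
      · rw [X_mul_zonalPoly_zero ha0, zonalForm_C_mul_left]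
      · rw [X_mul_zonalPoly_succ ha0, zonalForm_add_left, zonalForm_C_mul_left,
          zonalForm_C_mul_left, orth k (k + 1 + 1) (by omega), mul_zero, add_zero]
    have h2 : zonalForm x x (zonalPoly a k) (Polynomial.X * zonalPoly a (k + 1)) =
        (1 - zonalStep a k) * zonalForm x x (zonalPoly a k) (zonalPoly a k) := by
      rw [X_mul_zonalPoly_succ ha0, zonalForm_add_right, zonalForm_C_mul_right,
          zonalForm_C_mul_right, orth k (k + 2) (by omega), mul_zero, zero_add]
    rw [zonalForm_X_mul, h2, ih, ← zonalStep_mul_zonalPoly_eval_one ha0] at h1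
    exact (mul_left_cancel₀ (zonalStep_pos ha0 k).ne' h1).symm

/-- An algebraic substitute for rotation invariance: the moment recurrence involves the poles only
through `xᵀy`, polynomially. -/
lemma exists_sphereMoment_eq_eval (hp : 2 ≤ p) (i j : ℕ) : ∃ q : ℝ[X], ∀ x y : UnitSphere p,
    sphereMoment x y i j =
      q.eval (inner ℝ (x : EuclideanSpace ℝ (Fin p)) (y : EuclideanSpace ℝ (Fin p))) := by
  have hp' : (2 : ℝ) ≤ p := by exact_mod_cast hp
  induction hn : i + j using Nat.strong_induction_on generalizing i j with
  | _ n ih =>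
    have main : ∀ i j, i + 1 + j = n → ∃ q : ℝ[X], ∀ x y : UnitSphere p,
        sphereMoment x y (i + 1) j =
          q.eval (inner ℝ (x : EuclideanSpace ℝ (Fin p)) (y : EuclideanSpace ℝ (Fin p))) := by
      intro i j hij
      obtain ⟨q₁, h₁⟩ := ih (i - 1 + j) (by omega) (i - 1) j rfl
      obtain ⟨q₂, h₂⟩ := ih (i + (j - 1)) (by omega) i (j - 1) rfl
      refine ⟨Polynomial.C (1 / ((i : ℝ) + j + p - 1)) * (Polynomial.C (i : ℝ) * q₁ +
        Polynomial.C (j : ℝ) * Polynomial.X * q₂), fun x y => ?_⟩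
      have hpos : (0 : ℝ) < (i : ℝ) + j + p - 1 := by
        have : (0 : ℝ) ≤ (i : ℝ) + j := by positivity
        linarith
      simp only [Polynomial.eval_mul, Polynomial.eval_add, Polynomial.eval_C, Polynomial.eval_X,
        ← h₁ x y, ← h₂ x y, ← sphereMoment_succ x y i j]
      field_simp
    rcases i with _ | i
    · rcases j with _ | j
      · exact ⟨1, fun x y => by simp [sphereMoment_zero]⟩
      · obtain ⟨q, h⟩ := main j 0 (by omega)
        exact ⟨q, fun x y => by rw [sphereMoment_comm, h, real_inner_comm]⟩
    · exact main i j hn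

lemma exists_zonalForm_eq_eval (hp : 2 ≤ p) (f g : ℝ[X]) : ∃ q : ℝ[X], ∀ x y : UnitSphere p,
    zonalForm x y f g =
      q.eval (inner ℝ (x : EuclideanSpace ℝ (Fin p)) (y : EuclideanSpace ℝ (Fin p))) := by
  induction f using Polynomial.induction_on' with
  | add f₁ f₂ h₁ h₂ =>
    obtain ⟨q₁, h₁⟩ := h₁
    obtain ⟨q₂, h₂⟩ := h₂
    exact ⟨q₁ + q₂, fun x y => by rw [zonalForm_add_left, h₁, h₂, Polynomial.eval_add]⟩
  | monomial i c =>
    induction g using Polynomial.induction_on' with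
    | add g₁ g₂ h₁ h₂ =>
      obtain ⟨q₁, h₁⟩ := h₁
      obtain ⟨q₂, h₂⟩ := h₂
      exact ⟨q₁ + q₂, fun x y => by rw [zonalForm_add_right, h₁, h₂, Polynomial.eval_add]⟩
    | monomial j d =>
      obtain ⟨q, h⟩ := exists_sphereMoment_eq_eval hp i j
      refine ⟨Polynomial.C (c * d) * q, fun x y => ?_⟩
      rw [← Polynomial.C_mul_X_pow_eq_monomial, ← Polynomial.C_mul_X_pow_eq_monomial,
        zonalForm_C_mul_left, zonalForm_C_mul_right, zonalForm_X_pow, h, Polynomial.eval_mul,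
        Polynomial.eval_C, mul_assoc]

/-- Composition of zonal kernels, by Fubini. -/
lemma integral_zonalForm_mul_eval (x z : UnitSphere p) (f g h : ℝ[X]) :
    ∫ y, zonalForm x y f g *
      h.eval (inner ℝ (y : EuclideanSpace ℝ (Fin p)) (z : EuclideanSpace ℝ (Fin p)))
      ∂(uniformSphere p) =
    ∫ t, f.eval (inner ℝ (t : EuclideanSpace ℝ (Fin p)) (x : EuclideanSpace ℝ (Fin p))) *
      zonalForm t z g h ∂(uniformSphere p) := by
  simp only [zonalForm, ← integral_mul_const, ← integral_const_mul]
  rw [integral_integral_swap]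
  · refine integral_congr_ae (.of_forall fun t => integral_congr_ae (.of_forall fun y => ?_))
    simp only [real_inner_comm (t : EuclideanSpace ℝ (Fin p)) (y : EuclideanSpace ℝ (Fin p))]
    ring
  · refine Continuous.integrable_of_hasCompactSupport ?_ (HasCompactSupport.of_compactSpace _)
    fun_prop

/-- The reproducing property of the zonal polynomials. -/
lemma zonalForm_zonalPoly_self {a : ℝ} (ha : a = ((p : ℝ) - 2) / 2) (hp : 2 ≤ p)
    (x y : UnitSphere p) (k : ℕ) :
    zonalForm x y (zonalPoly a k) (zonalPoly a k) = (zonalPoly a k).eval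
      (inner ℝ (x : EuclideanSpace ℝ (Fin p)) (y : EuclideanSpace ℝ (Fin p))) := by
  have hp' : (2 : ℝ) ≤ p := by exact_mod_cast hp
  have ha0 : 0 ≤ a := by rw [ha]; linarith
  obtain ⟨q, hq⟩ := exists_zonalForm_eq_eval hp (zonalPoly a k) (zonalPoly a k)
  obtain ⟨n, c, hc⟩ := exists_eq_sum_zonalPoly ha0 q
  -- Write the form as `q(xᵀy)`. Integrating `q` against the kernel of degree `l` and exchanging the
  -- integrals leaves the pairing of degrees `k` and `l`, which is zero; so `q` has no component of
  -- degree `l`.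
  have hzero : ∀ l ∈ Finset.range n, l ≠ k → c l = 0 := by
    intro l hl hlk
    have h := integral_zonalForm_mul_eval x x (zonalPoly a k) (zonalPoly a k) (zonalPoly a l)
    simp only [hq, zonalForm_zonalPoly_of_ne ha hp _ x hlk.symm, mul_zero, integral_zero] at h
    have h' : zonalForm x x q (zonalPoly a l) = 0 := by
      rw [← h, zonalForm]
      simp only [real_inner_comm (x : EuclideanSpace ℝ (Fin p))]
    rw [hc, zonalForm_sum_left, Finset.sum_eq_single l] at h'
    · rw [zonalForm_C_mul_left, zonalForm_zonalPoly_self_diag ha hp] at h'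
      exact (mul_eq_zero.1 h').resolve_right (zonalPoly_eval_one_pos ha0 l).ne'
    · intro m _ hm
      rw [zonalForm_C_mul_left, zonalForm_zonalPoly_of_ne ha hp x x hm, mul_zero]
    · exact fun h => absurd hl h
  obtain ⟨d, hd⟩ : ∃ d : ℝ, q = Polynomial.C d * zonalPoly a k := by
    by_cases hk : k ∈ Finset.range n
    · refine ⟨c k, ?_⟩
      rw [hc, Finset.sum_eq_single_of_mem k hk]
      intro l hl hlk
      rw [hzero l hl hlk]
      simp
    · refine ⟨0, ?_⟩
      rw [hc, Finset.sum_eq_zero]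
      · simp
      · intro l hl
        rw [hzero l hl (fun h => hk (h ▸ hl))]
        simp
  -- Only a scalar multiple of `zonalPoly a k` is left; the diagonal value fixes the scalar.
  have h1 := hq x x
  rw [zonalForm_zonalPoly_self_diag ha hp, hd, Polynomial.eval_mul, Polynomial.eval_C,
    real_inner_self_eq_norm_sq, norm_eq_of_mem_sphere, one_pow] at h1
  have hd1 : d = 1 := by
    have := (zonalPoly_eval_one_pos ha0 k).ne'
    field_simp at h1
    exact h1.symm
  rw [hq, hd, hd1]
  simp

/-- A zonal polynomial is bounded on `[-1, 1]` by its value at `1`. -/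
lemma abs_zonalPoly_eval_inner_le {a : ℝ} (ha : a = ((p : ℝ) - 2) / 2) (hp : 2 ≤ p)
    (x y : UnitSphere p) (k : ℕ) :
    |(zonalPoly a k).eval (inner ℝ (x : EuclideanSpace ℝ (Fin p)) (y : EuclideanSpace ℝ (Fin p)))|
      ≤ (zonalPoly a k).eval 1 := by
  rw [← zonalForm_zonalPoly_self ha hp x y]
  have hx := zonalForm_zonalPoly_self_diag ha hp x k
  have hy := zonalForm_zonalPoly_self_diag ha hp y k
  -- Under the integral `|b c| ≤ b ^ 2 / 2 + c ^ 2 / 2`, and both squares integrate to the value at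
  -- `1`.
  have hI : zonalForm x x (zonalPoly a k) (zonalPoly a k) / 2 +
      zonalForm y y (zonalPoly a k) (zonalPoly a k) / 2 = (zonalPoly a k).eval 1 := by
    rw [hx, hy]; ring
  rw [← hI, ← Real.norm_eq_abs]
  simp only [zonalForm]
  rw [← integral_div, ← integral_div,
    ← integral_add ((integrable_zonal x x _ _).div_const 2) ((integrable_zonal y y _ _).div_const 2)]
  refine norm_integral_le_of_norm_le (((integrable_zonal x x _ _).div_const 2).add
    ((integrable_zonal y y _ _).div_const 2)) (.of_forall fun t => ?_)
  rw [Real.norm_eq_abs, abs_le]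
  constructor
  · nlinarith [sq_nonneg ((zonalPoly a k).eval
      (inner ℝ (t : EuclideanSpace ℝ (Fin p)) (x : EuclideanSpace ℝ (Fin p))) +
      (zonalPoly a k).eval
      (inner ℝ (t : EuclideanSpace ℝ (Fin p)) (y : EuclideanSpace ℝ (Fin p))))]
  · nlinarith [sq_nonneg ((zonalPoly a k).eval
      (inner ℝ (t : EuclideanSpace ℝ (Fin p)) (x : EuclideanSpace ℝ (Fin p))) -
      (zonalPoly a k).eval
      (inner ℝ (t : EuclideanSpace ℝ (Fin p)) (y : EuclideanSpace ℝ (Fin p))))]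

end ZonalForm

/-! ### Zonal expansion of the exponential and of its spherical Laplacian. -/

/-- The spherical Laplacian of `x ↦ exp (lam tᵀx)` as a function of `u = tᵀx`, for `p = 2 a + 2`. -/
noncomputable def steinProfile (a lam u : ℝ) : ℝ :=
  (lam ^ 2 * (1 - u ^ 2) - (2 * a + 1) * lam * u) * Real.exp (lam * u)

/-- The coefficient of `zonalPoly a k` in the expansion of `u ↦ exp (lam u)`. -/
noncomputable def expCoeff (a lam : ℝ) (k : ℕ) : ℝ :=
  ∑' n : ℕ, lam ^ n / n.factorial * powCoeff a n k

section Series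

variable {a lam : ℝ}

lemma hasSum_pow_div_factorial (z : ℝ) :
    HasSum (fun n : ℕ => z ^ n / n.factorial) (Real.exp z) := by
  rw [Real.exp_eq_exp_ℝ]
  exact NormedSpace.expSeries_div_hasSum_exp z

lemma hasSum_mul_pow_div_factorial (z : ℝ) :
    HasSum (fun n : ℕ => (n : ℝ) * (z ^ n / n.factorial)) (z * Real.exp z) := by
  rw [← hasSum_nat_add_iff' 1]
  simp only [Finset.sum_range_one, Nat.cast_zero, zero_mul, sub_zero]
  refine ((hasSum_pow_div_factorial z).mul_left z).congr_fun fun n => ?_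
  rw [Nat.factorial_succ]
  push_cast
  field_simp
  ring

lemma hasSum_mul_pow_sub_two_div_factorial (lam u : ℝ) :
    HasSum (fun n : ℕ => (n : ℝ) * (n - 1) * (lam ^ n / n.factorial * u ^ (n - 2)))
      (lam ^ 2 * Real.exp (lam * u)) := by
  rw [← hasSum_nat_add_iff' 2]
  simp only [Finset.sum_range_succ, Finset.sum_range_zero]
  norm_num
  refine ((hasSum_pow_div_factorial (lam * u)).mul_left (lam ^ 2)).congr_fun fun n => ?_
  rw [Nat.factorial_succ (n + 1), Nat.factorial_succ n, mul_pow]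
  push_cast
  field_simp
  ring

lemma hasSum_mul_sub_one_mul_pow_div_factorial (z : ℝ) :
    HasSum (fun n : ℕ => (n : ℝ) * (n - 1) * (z ^ n / n.factorial)) (z ^ 2 * Real.exp z) := by
  have h := hasSum_mul_pow_sub_two_div_factorial z 1
  simpa using h

/-- `steinProfile` is the Gegenbauer operator applied to `exp (lam u)`, here termwise on the power
series. -/
lemma hasSum_gegenbauerOp_X_pow (u : ℝ) :
    HasSum (fun n : ℕ => lam ^ n / n.factorial * (gegenbauerOp a (Polynomial.X ^ n)).eval u)
      (steinProfile a lam u) := by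
  have h := (hasSum_mul_pow_sub_two_div_factorial lam u).sub
    ((hasSum_mul_sub_one_mul_pow_div_factorial (lam * u)).add
      ((hasSum_mul_pow_div_factorial (lam * u)).mul_left (2 * a + 1)))
  have e : steinProfile a lam u = lam ^ 2 * Real.exp (lam * u) -
      ((lam * u) ^ 2 * Real.exp (lam * u) + (2 * a + 1) * (lam * u * Real.exp (lam * u))) := by
    unfold steinProfile; ring
  rw [e]
  refine h.congr_fun fun n => ?_
  rw [gegenbauerOp_X_pow, mul_pow]
  simp
  ring

lemma hasSum_powCoeff_mul (a : ℝ) (n : ℕ) (c : ℕ → ℝ) :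
    HasSum (fun k => powCoeff a n k * c k) (∑ k ∈ Finset.range (n + 1), powCoeff a n k * c k) :=
  hasSum_sum_of_ne_finset_zero fun k hk => by
    rw [powCoeff_eq_zero_of_lt (by simpa using hk), zero_mul]

/-- Expanding `1 ^ n` at `u = 1` gives nonnegative terms of sum one, hence `powCoeff a n k ≤ 1 /
(zonalPoly a k).eval 1`. -/
lemma summable_expCoeff (ha : 0 ≤ a) (hlam : 0 < lam) (k : ℕ) :
    Summable fun n : ℕ => lam ^ n / n.factorial * powCoeff a n k := by
  have hQ := zonalPoly_eval_one_pos ha k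
  refine Summable.of_nonneg_of_le (fun n => mul_nonneg (by positivity) (powCoeff_nonneg ha n k))
    (fun n => ?_) ((hasSum_pow_div_factorial lam).summable.mul_right (1 / (zonalPoly a k).eval 1))
  refine mul_le_mul_of_nonneg_left ?_ (by positivity)
  rw [le_div_iff₀ hQ]
  by_cases hk : k ∈ Finset.range (n + 1)
  · have h := pow_eq_sum_zonalPoly ha n 1
    rw [one_pow] at h
    refine le_of_le_of_eq ?_ h.symm
    exact Finset.single_le_sum (f := fun k => powCoeff a n k * (zonalPoly a k).eval 1)
      (fun i _ => mul_nonneg (powCoeff_nonneg ha n i) (zonalPoly_eval_one_pos ha i).le) hk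
  · rw [powCoeff_eq_zero_of_lt (by simpa using hk)]
    simp

lemma expCoeff_nonneg (ha : 0 ≤ a) (hlam : 0 < lam) (k : ℕ) : 0 ≤ expCoeff a lam k :=
  tsum_nonneg fun n => mul_nonneg (by positivity) (powCoeff_nonneg ha n k)

/-- The zonal expansion of `steinProfile`. -/
lemma hasSum_steinProfile (ha : 0 ≤ a) (hlam : 0 < lam) {u : ℝ}
    (hu : ∀ k, |(zonalPoly a k).eval u| ≤ (zonalPoly a k).eval 1) :
    HasSum (fun k : ℕ => -(expCoeff a lam k * (k * (k + 2 * a))) * (zonalPoly a k).eval u)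
      (steinProfile a lam u) := by
  set G : ℕ × ℕ → ℝ := fun z => lam ^ z.1 / z.1.factorial *
    (powCoeff a z.1 z.2 * (-((z.2 : ℝ) * (z.2 + 2 * a)) * (zonalPoly a z.2).eval u)) with hG
  -- The majorant has `n (n + 2 a)` in place of `k (k + 2 a)`, which is legitimate because the
  -- coefficients vanish for `k > n`. Its row sums are then explicit.
  set D : ℕ × ℕ → ℝ := fun z => lam ^ z.1 / z.1.factorial *
    (powCoeff a z.1 z.2 * ((z.1 : ℝ) * (z.1 + 2 * a) * (zonalPoly a z.2).eval 1)) with hD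
  have hQ1 : ∀ k, 0 < (zonalPoly a k).eval 1 := zonalPoly_eval_one_pos ha
  have hDn : ∀ n, HasSum (fun k => D (n, k)) (lam ^ n / n.factorial * (n * (n + 2 * a))) := by
    intro n
    have h := (hasSum_powCoeff_mul a n
      (fun k => (n : ℝ) * (n + 2 * a) * (zonalPoly a k).eval 1)).mul_left
        (lam ^ n / n.factorial)
    have e : ∑ k ∈ Finset.range (n + 1), powCoeff a n k *
        ((n : ℝ) * (n + 2 * a) * (zonalPoly a k).eval 1) = n * (n + 2 * a) := by
      have := pow_eq_sum_zonalPoly ha n 1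
      simp only [mul_left_comm (powCoeff a n _)]
      rw [← Finset.mul_sum, ← this]
      simp
    rwa [e] at h
  have hDsum : Summable D := by
    rw [summable_prod_of_nonneg]
    · refine ⟨fun n => (hDn n).summable, ?_⟩
      simp only [fun n => (hDn n).tsum_eq]
      have h := ((hasSum_mul_sub_one_mul_pow_div_factorial lam).add
        ((hasSum_mul_pow_div_factorial lam).mul_left (2 * a + 1))).summable
      refine h.congr fun n => ?_
      ring
    · intro z
      have := powCoeff_nonneg ha z.1 z.2
      have := (hQ1 z.2).le
      simp only [hD, Pi.zero_apply]
      positivity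
  have hGsum : Summable G := by
    refine Summable.of_norm_bounded hDsum fun z => ?_
    have hb := powCoeff_nonneg ha z.1 z.2
    by_cases hz : z.1 < z.2
    · simp [hG, hD, powCoeff_eq_zero_of_lt hz]
    · have hz' : (z.2 : ℝ) ≤ z.1 := by exact_mod_cast not_lt.1 hz
      simp only [hG, hD, norm_mul, Real.norm_eq_abs, abs_of_nonneg hb, abs_neg]
      rw [abs_of_nonneg (by positivity : 0 ≤ lam ^ z.1 / (z.1.factorial : ℝ)),
        abs_of_nonneg (by positivity : 0 ≤ (z.2 : ℝ) * (z.2 + 2 * a))]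
      gcongr
      exact hu z.2
  have hS := hGsum.hasSum
  have hn : ∀ n, HasSum (fun k => G (n, k))
      (lam ^ n / n.factorial * (gegenbauerOp a (Polynomial.X ^ n)).eval u) := by
    intro n
    have h := (hasSum_powCoeff_mul a n
      (fun k => -((k : ℝ) * (k + 2 * a)) * (zonalPoly a k).eval u)).mul_left
        (lam ^ n / n.factorial)
    have e : ∑ k ∈ Finset.range (n + 1), powCoeff a n k *
        (-((k : ℝ) * (k + 2 * a)) * (zonalPoly a k).eval u) =
        (gegenbauerOp a (Polynomial.X ^ n)).eval u := by
      rw [sum_powCoeff_eigen ha, Polynomial.eval_finsetSum]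
      refine Finset.sum_congr rfl fun k _ => ?_
      rw [Polynomial.eval_mul, Polynomial.eval_C]
      ring
    rwa [e] at h
  -- Summing the double series by rows identifies its value; summing it by columns gives the zonal
  -- expansion.
  have hval := (hS.prod_fiberwise hn).unique (hasSum_gegenbauerOp_X_pow (a := a) (lam := lam) u)
  rw [hval] at hS
  have hS' : HasSum (fun z : ℕ × ℕ => G (z.2, z.1)) (steinProfile a lam u) :=
    (Equiv.prodComm ℕ ℕ).hasSum_iff.2 hS
  refine hS'.prod_fiberwise fun k => ?_
  have h := (summable_expCoeff ha hlam k).hasSum.mul_right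
    (-((k : ℝ) * (k + 2 * a)) * (zonalPoly a k).eval u)
  have e : -(expCoeff a lam k * (k * (k + 2 * a))) * (zonalPoly a k).eval u =
      expCoeff a lam k * (-((k : ℝ) * (k + 2 * a)) * (zonalPoly a k).eval u) := by ring
  rw [e]
  refine h.congr_fun fun n => ?_
  simp only [hG]
  ring

/-- At `u = 1` all terms of the expansion have the same sign; this series is the uniform majorant
for termwise integration. -/
lemma summable_expCoeff_mul_eval_one (ha : 0 ≤ a) (hlam : 0 < lam) :
    Summable fun k : ℕ => expCoeff a lam k * (k * (k + 2 * a)) * (zonalPoly a k).eval 1 := by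
  have h := (hasSum_steinProfile ha hlam (u := 1)
    fun k => (abs_of_pos (zonalPoly_eval_one_pos ha k)).le).summable.neg
  simpa using h

lemma risingFactorial_eq_Gamma (ha : 0 ≤ a) (m : ℕ) :
    Real.Gamma (m + a + 1) = risingFactorial a m * Real.Gamma (a + 1) := by
  induction m with
  | zero => simp [risingFactorial]
  | succ m ih =>
    rw [risingFactorial_succ, show ((m + 1 : ℕ) : ℝ) + a + 1 = (m + a + 1) + 1 by push_cast; ring,
      Real.Gamma_add_one (by positivity), ih]
    ring

/-- The zonal coefficients of `u ↦ exp (lam u)` in terms of the modified Bessel function. -/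
lemma expCoeff_eq_besselI (ha : 0 ≤ a) (hlam : 0 < lam) (k : ℕ) :
    expCoeff a lam k = Real.Gamma (a + 1) * ((lam / 2) ^ a)⁻¹ * besselI (a + k) lam := by
  -- Only the indices `n = k + 2 j` contribute; `j` becomes the index of the Bessel series.
  have hinj : Function.Injective fun j : ℕ => k + 2 * j := fun i j h => by
    simp only at h; omega
  rw [expCoeff, besselI, ← tsum_mul_left, ← hinj.tsum_eq]
  · refine tsum_congr fun j => ?_
    have hr := risingFactorial_pos ha (k + j)
    have hl : 0 < lam / 2 := by positivity
    have hla := Real.rpow_pos_of_pos hl a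
    have hG := Real.Gamma_pos_of_pos (show 0 < a + 1 by positivity)
    have e1 := risingFactorial_eq_Gamma ha (k + j)
    rw [powCoeff_add_two_mul ha, show (j : ℝ) + (a + k) + 1 = ((k + j : ℕ) : ℝ) + a + 1 by
      push_cast; ring, e1, show 2 * (j : ℝ) + (a + k) = a + ((k + 2 * j : ℕ) : ℝ) by
      push_cast; ring, Real.rpow_add hl, Real.rpow_natCast, div_pow]
    have := Nat.factorial_pos (k + 2 * j)
    field_simp
  · intro n hn
    by_contra h
    refine hn ?_
    simp only [Set.mem_range, not_exists] at h
    change lam ^ n / n.factorial * powCoeff a n k = 0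
    rw [powCoeff_eq_zero fun j hj => h j hj.symm, mul_zero]

end Series

/-! ### Integrals of zonal series over the sphere. -/

section SphereIntegral

variable {p : ℕ} [NeZero p] {a lam : ℝ}

lemma continuous_steinProfile : Continuous (steinProfile a lam) := by
  unfold steinProfile; fun_prop

lemma hasSum_integral_mul_steinProfile (ha : a = ((p : ℝ) - 2) / 2) (hp : 2 ≤ p) (hlam : 0 < lam)
    (y : UnitSphere p) {f : UnitSphere p → ℝ} (hf : Continuous f) :
    HasSum (fun k : ℕ => -(expCoeff a lam k * (k * (k + 2 * a))) * ∫ t : UnitSphere p, f t *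
      (zonalPoly a k).eval (inner ℝ (t : EuclideanSpace ℝ (Fin p)) (y : EuclideanSpace ℝ (Fin p)))
      ∂(uniformSphere p))
    (∫ t : UnitSphere p, f t * steinProfile a lam
      (inner ℝ (t : EuclideanSpace ℝ (Fin p)) (y : EuclideanSpace ℝ (Fin p)))
      ∂(uniformSphere p)) := by
  have hp' : (2 : ℝ) ≤ p := by exact_mod_cast hp
  have ha0 : 0 ≤ a := by rw [ha]; linarith
  obtain ⟨B, hB⟩ := isCompact_univ.exists_bound_of_continuousOn (f := f) hf.continuousOn
  have hB0 : 0 ≤ B := (norm_nonneg _).trans (hB y (Set.mem_univ y))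
  set c : ℕ → ℝ := fun k => expCoeff a lam k * (k * (k + 2 * a)) with hc
  have hc0 : ∀ k, 0 ≤ c k := fun k => mul_nonneg (expCoeff_nonneg ha0 hlam k) (by positivity)
  set F : ℕ → UnitSphere p → ℝ := fun k t => f t * (-(c k) * (zonalPoly a k).eval
    (inner ℝ (t : EuclideanSpace ℝ (Fin p)) (y : EuclideanSpace ℝ (Fin p)))) with hF
  have hFc : ∀ k, Continuous (F k) := fun k => by fun_prop
  have key := hasSum_integral_of_summable_integral_norm (μ := uniformSphere p) (F := F)
    (fun k => integrable_uniformSphere_of_continuous (hFc k)) ?_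
  · have e : ∀ t : UnitSphere p, ∑' k, F k t = f t * steinProfile a lam
        (inner ℝ (t : EuclideanSpace ℝ (Fin p)) (y : EuclideanSpace ℝ (Fin p))) := fun t =>
      ((hasSum_steinProfile ha0 hlam
        (fun k => abs_zonalPoly_eval_inner_le ha hp t y k)).mul_left (f t)).tsum_eq
    simp only [e] at key
    refine key.congr_fun fun k => ?_
    rw [← integral_const_mul]
    refine integral_congr_ae (.of_forall fun t => ?_)
    simp only [hF]
    ring
  · refine Summable.of_nonneg_of_le (fun k => integral_nonneg fun t => norm_nonneg _) (fun k => ?_)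
      ((summable_expCoeff_mul_eval_one ha0 hlam).mul_left B)
    have h : ∀ t, ‖F k t‖ ≤ B * (c k * (zonalPoly a k).eval 1) := by
      intro t
      simp only [hF, norm_mul, norm_neg]
      rw [Real.norm_of_nonneg (hc0 k), Real.norm_eq_abs (Polynomial.eval _ _)]
      have := hc0 k
      gcongr
      · exact hB t (Set.mem_univ t)
      · exact abs_zonalPoly_eval_inner_le ha hp t y k
    refine (integral_mono (integrable_uniformSphere_of_continuous (hFc k).norm)
      (integrable_const _) h).trans ?_
    simp [hc]

/-- A Funk–Hecke formula: orthogonality keeps only degree `k` of the expansion, and the reproducing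
property evaluates it. -/
lemma integral_zonalPoly_mul_steinProfile (ha : a = ((p : ℝ) - 2) / 2) (hp : 2 ≤ p)
    (hlam : 0 < lam) (x y : UnitSphere p) (k : ℕ) :
    ∫ t : UnitSphere p, (zonalPoly a k).eval
      (inner ℝ (t : EuclideanSpace ℝ (Fin p)) (x : EuclideanSpace ℝ (Fin p))) * steinProfile a lam
      (inner ℝ (t : EuclideanSpace ℝ (Fin p)) (y : EuclideanSpace ℝ (Fin p)))
      ∂(uniformSphere p) = -(expCoeff a lam k * (k * (k + 2 * a))) *
      (zonalPoly a k).eval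
        (inner ℝ (x : EuclideanSpace ℝ (Fin p)) (y : EuclideanSpace ℝ (Fin p))) := by
  have h := hasSum_integral_mul_steinProfile ha hp hlam y (f := fun t => (zonalPoly a k).eval
      (inner ℝ (t : EuclideanSpace ℝ (Fin p)) (x : EuclideanSpace ℝ (Fin p)))) (by fun_prop)
  rw [← zonalForm_zonalPoly_self ha hp]
  refine h.unique (hasSum_single k fun l hl => ?_)
  have := zonalForm_zonalPoly_of_ne ha hp x y hl.symm
  rw [zonalForm] at this
  rw [this, mul_zero]

/-- The zonal expansion of the kernel `∫ h(tᵀx) h(tᵀy) dν(t)`, for `h = steinProfile a lam`. -/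
lemma hasSum_integral_steinProfile_mul_steinProfile (ha : a = ((p : ℝ) - 2) / 2) (hp : 2 ≤ p)
    (hlam : 0 < lam) (x y : UnitSphere p) :
    HasSum (fun k : ℕ => (expCoeff a lam k * (k * (k + 2 * a))) ^ 2 * (zonalPoly a k).eval
        (inner ℝ (x : EuclideanSpace ℝ (Fin p)) (y : EuclideanSpace ℝ (Fin p))))
      (∫ t : UnitSphere p, steinProfile a lam
        (inner ℝ (t : EuclideanSpace ℝ (Fin p)) (x : EuclideanSpace ℝ (Fin p))) *
        steinProfile a lam
        (inner ℝ (t : EuclideanSpace ℝ (Fin p)) (y : EuclideanSpace ℝ (Fin p)))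
        ∂(uniformSphere p)) := by
  have h := hasSum_integral_mul_steinProfile ha hp hlam y (f := fun t => steinProfile a lam
    (inner ℝ (t : EuclideanSpace ℝ (Fin p)) (x : EuclideanSpace ℝ (Fin p))))
    (continuous_steinProfile.comp (by fun_prop))
  refine h.congr_fun fun k => ?_
  -- Each integral in the expansion yields the same coefficient a second time, hence the square.
  have h2 := integral_zonalPoly_mul_steinProfile ha hp hlam y x k
  simp only [mul_comm (Polynomial.eval _ _) (steinProfile _ _ _)] at h2
  rw [h2, real_inner_comm]
  ring

end SphereIntegral

/-! ### The ultraspherical weight, Gegenbauer coefficients and Bessel functions. -/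

/-- The functional `∫_0^π f(cos θ) sin^(p-2) θ dθ` on polynomials. -/
noncomputable def cosineIntegral (p : ℕ) (f : ℝ[X]) : ℝ :=
  ∫ θ in (0 : ℝ)..Real.pi, f.eval (Real.cos θ) * Real.sin θ ^ (p - 2)

section WeightedIntegral

variable {p : ℕ}

/-- The substitution `u = cos θ` in the ultraspherical weight. -/
lemma integral_mul_weight_eq_integral_cos (hp : 2 ≤ p) (f : ℝ → ℝ) :
    ∫ u in (-1 : ℝ)..1, f u * (1 - u ^ 2) ^ (((p : ℝ) - 3) / 2) =
      ∫ θ in (0 : ℝ)..Real.pi, f (Real.cos θ) * Real.sin θ ^ (p - 2) := by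
  rw [intervalIntegral.integral_of_le (by norm_num), intervalIntegral.integral_of_le Real.pi_pos.le,
    ← integral_Icc_eq_integral_Ioc, ← Real.bijOn_cos.image_eq,
    integral_image_eq_integral_abs_deriv_smul measurableSet_Icc
      (fun θ _ => (Real.hasDerivAt_cos θ).hasDerivWithinAt) Real.injOn_cos,
    integral_Icc_eq_integral_Ioo, integral_Ioc_eq_integral_Ioo]
  -- On the open interval `sin θ > 0`, as needed for the negative exponent when `p = 2`.
  refine setIntegral_congr_fun measurableSet_Ioo fun θ hθ => ?_
  have hs : 0 < Real.sin θ := Real.sin_pos_of_mem_Ioo hθ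
  have e : Real.sin θ * (1 - Real.cos θ ^ 2) ^ (((p : ℝ) - 3) / 2) = Real.sin θ ^ (p - 2) := by
    rw [← Real.sin_sq, ← Real.rpow_natCast (Real.sin θ) 2, ← Real.rpow_mul hs.le,
      ← Real.rpow_natCast (Real.sin θ) (p - 2)]
    nth_rewrite 1 [← Real.rpow_one (Real.sin θ)]
    rw [← Real.rpow_add hs]
    congr 1
    push_cast [Nat.cast_sub hp]
    ring
  simp only [abs_neg, abs_of_pos hs, smul_eq_mul]
  rw [← e]
  ring

lemma weightedInner_eq_integral_cos (hp : 2 ≤ p) (f g : ℝ → ℝ) :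
    weightedInner p f g =
      ∫ θ in (0 : ℝ)..Real.pi, f (Real.cos θ) * g (Real.cos θ) * Real.sin θ ^ (p - 2) :=
  integral_mul_weight_eq_integral_cos hp fun u => f u * g u

lemma cosineIntegral_add (f g : ℝ[X]) :
    cosineIntegral p (f + g) = cosineIntegral p f + cosineIntegral p g := by
  simp only [cosineIntegral, Polynomial.eval_add, add_mul]
  exact intervalIntegral.integral_add (Continuous.intervalIntegrable (by fun_prop) _ _)
    (Continuous.intervalIntegrable (by fun_prop) _ _)

lemma cosineIntegral_C_mul (c : ℝ) (f : ℝ[X]) :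
    cosineIntegral p (Polynomial.C c * f) = c * cosineIntegral p f := by
  simp only [cosineIntegral, Polynomial.eval_mul, Polynomial.eval_C, mul_assoc,
    intervalIntegral.integral_const_mul]

lemma cosineIntegral_one_pos : 0 < cosineIntegral p 1 := by
  simpa [cosineIntegral] using integral_sin_pow_pos (n := p - 2)

lemma cosineIntegral_X (hp : 2 ≤ p) : cosineIntegral p Polynomial.X = 0 := by
  obtain ⟨q, rfl⟩ := Nat.exists_eq_add_of_le' hp
  have h := intervalIntegral.integral_eq_sub_of_hasDerivAt (a := 0) (b := Real.pi)
    (f := fun θ => Real.sin θ ^ (q + 1))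
    (f' := fun θ => (q + 1) * (Real.cos θ * Real.sin θ ^ q))
    (fun θ _ => ((Real.hasDerivAt_sin θ).fun_pow (q + 1)).congr_deriv (by push_cast; ring))
    (Continuous.intervalIntegrable (by fun_prop) _ _)
  rw [intervalIntegral.integral_const_mul] at h
  simp only [Real.sin_pi, Real.sin_zero, sub_self] at h
  have hq : (q : ℝ) + 1 ≠ 0 := by positivity
  simpa [cosineIntegral, hq] using h

/-- Integrate the derivative of `cos ^ (n + 1) * sin ^ (p - 1)`, which vanishes at both endpoints.
-/
lemma cosineIntegral_X_pow_add_two (hp : 2 ≤ p) (n : ℕ) :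
    ((n : ℝ) + p) * cosineIntegral p (Polynomial.X ^ (n + 2)) =
      (n + 1) * cosineIntegral p (Polynomial.X ^ n) := by
  obtain ⟨q, rfl⟩ := Nat.exists_eq_add_of_le' hp
  have h := intervalIntegral.integral_eq_sub_of_hasDerivAt (a := 0) (b := Real.pi)
    (f := fun θ => Real.cos θ ^ (n + 1) * Real.sin θ ^ (q + 1))
    (f' := fun θ => ((n : ℝ) + (q + 2)) * (Real.cos θ ^ (n + 2) * Real.sin θ ^ q) -
      (n + 1) * (Real.cos θ ^ n * Real.sin θ ^ q))
    (fun θ _ => (((Real.hasDerivAt_cos θ).fun_pow (n + 1)).fun_mul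
      ((Real.hasDerivAt_sin θ).fun_pow (q + 1))).congr_deriv (by
        push_cast
        have := Real.sin_sq θ
        linear_combination (-(n + 1) * Real.cos θ ^ n * Real.sin θ ^ q) * this))
    (Continuous.intervalIntegrable (by fun_prop) _ _)
  rw [intervalIntegral.integral_sub (Continuous.intervalIntegrable (by fun_prop) _ _)
    (Continuous.intervalIntegrable (by fun_prop) _ _), intervalIntegral.integral_const_mul,
    intervalIntegral.integral_const_mul] at h
  simp only [Real.sin_pi, Real.sin_zero, zero_pow (Nat.succ_ne_zero q), mul_zero, sub_self] at h
  simp only [cosineIntegral, Polynomial.eval_pow, Polynomial.eval_X, Nat.add_sub_cancel]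
  push_cast
  linarith

/-- Both sides satisfy the same two-step recurrence with the same initial values, up to the total
mass. -/
lemma cosineIntegral_X_pow (hp : 2 ≤ p) [NeZero p] (x : UnitSphere p) (n : ℕ) :
    cosineIntegral p (Polynomial.X ^ n) = cosineIntegral p 1 * sphereMoment x x n 0 := by
  have hp' : (2 : ℝ) ≤ p := by exact_mod_cast hp
  induction n using Nat.twoStepInduction with
  | zero => simp [sphereMoment_zero]
  | one =>
    have h := sphereMoment_succ x x 0 0
    simp only [Nat.cast_zero, zero_mul, zero_add, add_zero] at h
    have h0 : sphereMoment x x 1 0 = 0 :=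
      (mul_eq_zero.1 h).resolve_left (by linarith)
    rw [pow_one, cosineIntegral_X hp, h0, mul_zero]
  | more n ih _ =>
    have h1 := sphereMoment_succ x x (n + 1) 0
    have h2 := cosineIntegral_X_pow_add_two hp n
    simp only [Nat.cast_zero, zero_mul, add_zero, Nat.add_sub_cancel] at h1
    push_cast at h1
    have hpos : (0 : ℝ) < n + p := by positivity
    refine mul_left_cancel₀ hpos.ne' ?_
    rw [h2, ih]
    linear_combination (-cosineIntegral p 1) * h1

/-- Integration against the ultraspherical weight is integration of zonal functions on the
sphere, up to a constant. -/
lemma cosineIntegral_eq_zonalForm (hp : 2 ≤ p) [NeZero p] (x : UnitSphere p) (f : ℝ[X]) :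
    cosineIntegral p f = cosineIntegral p 1 * zonalForm x x f 1 := by
  induction f using Polynomial.induction_on' with
  | add f g hf hg => rw [cosineIntegral_add, zonalForm_add_left, hf, hg, mul_add]
  | monomial n c =>
    rw [← Polynomial.C_mul_X_pow_eq_monomial, cosineIntegral_C_mul, zonalForm_C_mul_left,
      cosineIntegral_X_pow hp x, ← pow_zero Polynomial.X, zonalForm_X_pow]
    ring

lemma cosineIntegral_mul (hp : 2 ≤ p) [NeZero p] (x : UnitSphere p) (f g : ℝ[X]) :
    cosineIntegral p (f * g) = cosineIntegral p 1 * zonalForm x x f g := by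
  rw [cosineIntegral_eq_zonalForm hp x]
  simp [zonalForm]

variable {a lam : ℝ}

lemma cosineIntegral_X_pow_mul_zonalPoly (ha : a = ((p : ℝ) - 2) / 2) (hp : 2 ≤ p)
    [NeZero p] (x : UnitSphere p) (n k : ℕ) :
    cosineIntegral p (Polynomial.X ^ n * zonalPoly a k) =
      cosineIntegral p 1 * (powCoeff a n k * (zonalPoly a k).eval 1) := by
  have hp' : (2 : ℝ) ≤ p := by exact_mod_cast hp
  have ha0 : 0 ≤ a := by rw [ha]; linarith
  rw [cosineIntegral_mul hp x, X_pow_eq_sum_zonalPoly ha0, zonalForm_sum_left]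
  congr 1
  rw [Finset.sum_eq_single k]
  · rw [zonalForm_C_mul_left, zonalForm_zonalPoly_self_diag ha hp]
  · intro m _ hm
    rw [zonalForm_C_mul_left, zonalForm_zonalPoly_of_ne ha hp x x hm, mul_zero]
  · intro hk
    rw [powCoeff_eq_zero_of_lt (by simpa using hk)]
    simp [zonalForm]

lemma integral_exp_mul_zonalPoly (ha : a = ((p : ℝ) - 2) / 2) (hp : 2 ≤ p) [NeZero p]
    (hlam : 0 < lam) (x : UnitSphere p) (k : ℕ) :
    ∫ θ in (0 : ℝ)..Real.pi, Real.exp (lam * Real.cos θ) * (zonalPoly a k).eval (Real.cos θ) *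
      Real.sin θ ^ (p - 2) =
    cosineIntegral p 1 * (expCoeff a lam k * (zonalPoly a k).eval 1) := by
  have hp' : (2 : ℝ) ≤ p := by exact_mod_cast hp
  have ha0 : 0 ≤ a := by rw [ha]; linarith
  have h1 : HasSum (fun n : ℕ => ∫ θ in (0 : ℝ)..Real.pi, lam ^ n / n.factorial *
      ((Polynomial.X ^ n * zonalPoly a k).eval (Real.cos θ) * Real.sin θ ^ (p - 2)))
      (∫ θ in (0 : ℝ)..Real.pi, Real.exp (lam * Real.cos θ) * (zonalPoly a k).eval (Real.cos θ) *
      Real.sin θ ^ (p - 2)) := by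
    refine intervalIntegral.hasSum_integral_of_dominated_convergence
      (fun n θ => lam ^ n / n.factorial *
        |(zonalPoly a k).eval (Real.cos θ) * Real.sin θ ^ (p - 2)|) (fun n => ?_) (fun n => ?_)
      ?_ ?_ ?_
    · exact Continuous.aestronglyMeasurable (by fun_prop)
    · refine .of_forall fun θ _ => ?_
      simp only [Polynomial.eval_mul, Polynomial.eval_pow, Polynomial.eval_X, mul_assoc]
      rw [norm_mul, norm_mul, norm_pow, Real.norm_of_nonneg (by positivity), Real.norm_eq_abs,
        Real.norm_eq_abs]
      have := pow_le_one₀ (n := n) (abs_nonneg _) (Real.abs_cos_le_one θ)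
      exact mul_le_mul_of_nonneg_left (mul_le_of_le_one_left (abs_nonneg _) this) (by positivity)
    · exact .of_forall fun θ _ => (hasSum_pow_div_factorial lam).summable.mul_right _
    · simp only [tsum_mul_right]
      exact Continuous.intervalIntegrable (by fun_prop) _ _
    · refine .of_forall fun θ _ => ?_
      have h := (hasSum_pow_div_factorial (lam * Real.cos θ)).mul_right
        ((zonalPoly a k).eval (Real.cos θ) * Real.sin θ ^ (p - 2))
      rw [← mul_assoc] at h
      refine h.congr_fun fun n => ?_
      simp only [Polynomial.eval_mul, Polynomial.eval_pow, Polynomial.eval_X, mul_pow]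
      ring
  refine h1.unique ?_
  refine (((summable_expCoeff ha0 hlam k).hasSum.mul_right
    ((zonalPoly a k).eval 1)).mul_left (cosineIntegral p 1)).congr_fun fun n => ?_
  have h2 := cosineIntegral_X_pow_mul_zonalPoly ha hp x n k
  rw [cosineIntegral] at h2
  rw [intervalIntegral.integral_const_mul, h2]
  ring

lemma gegenbauerRec_eq_zonalPoly (ha : 0 < a) (k : ℕ) (u : ℝ) :
    gegenbauerRec a k u = a / (k + a) * (zonalPoly a k).eval u := by
  induction k using Nat.twoStepInduction with
  | zero =>
    simp [gegenbauerRec, zonalPoly, ha.ne']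
  | one =>
    simp [gegenbauerRec, zonalPoly]
    field_simp
  | more k h0 h1 =>
    rw [gegenbauerRec, h0, h1, zonalPoly]
    have : (0 : ℝ) < k + 1 + a := by positivity
    have : (0 : ℝ) < k + 2 + a := by positivity
    simp only [Polynomial.eval_mul, Polynomial.eval_sub, Polynomial.eval_C, Polynomial.eval_X,
      zonalStep]
    push_cast
    field_simp
    ring

/-- The case `p = 2`: twice the Chebyshev polynomials. Degree `0` is excluded, since there the zonal
polynomial is `1` and not `2`. -/
lemma zonalPoly_zero_eval_cos (k : ℕ) (θ : ℝ) :
    (zonalPoly 0 (k + 1)).eval (Real.cos θ) = 2 * Real.cos (((k + 1 : ℕ) : ℝ) * θ) := by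
  have hs : ∀ k, zonalStep 0 (k + 1) = 1 / 2 := by
    intro k
    unfold zonalStep
    push_cast
    field_simp
    ring
  induction k using Nat.twoStepInduction with
  | zero => simp [zonalPoly]
  | one =>
    rw [zonalPoly, hs, zonalStep_zero]
    simp [zonalPoly, one_add_one_eq_two, Real.cos_two_mul]
    ring
  | more k h0 h1 =>
    rw [zonalPoly, hs, hs]
    simp only [Polynomial.eval_mul, Polynomial.eval_sub, Polynomial.eval_C, Polynomial.eval_X,
      h0, h1]
    have e1 : Real.cos (((k + 1 : ℕ) : ℝ) * θ) =
        Real.cos (((k + 1 + 1 : ℕ) : ℝ) * θ - θ) := by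
      congr 1; push_cast; ring
    have e2 : Real.cos (((k + 2 + 1 : ℕ) : ℝ) * θ) =
        Real.cos (((k + 1 + 1 : ℕ) : ℝ) * θ + θ) := by
      congr 1; push_cast; ring
    rw [e1, e2, Real.cos_sub, Real.cos_add]
    ring

lemma gammaConst_pos (hp : 2 ≤ p) (k : ℕ) : 0 < gammaConst p (k + 1) := by
  have hp' : (2 : ℝ) ≤ p := by exact_mod_cast hp
  unfold gammaConst
  split_ifs with h1 h2
  · exact absurd h2 (by simp)
  · norm_num
  · have : (2 : ℝ) < p := lt_of_le_of_ne hp' (by exact_mod_cast Ne.symm h1)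
    have : (0 : ℝ) < p - 2 := by linarith
    rw [add_sub_assoc]
    positivity

/-- The Gegenbauer polynomials are multiples of the zonal polynomials. -/
lemma gegenbauer_eq_zonalPoly (ha : a = ((p : ℝ) - 2) / 2) (hp : 2 ≤ p) (k : ℕ) {u : ℝ}
    (hu : u ∈ Set.Icc (-1 : ℝ) 1) :
    gegenbauer (((p : ℝ) - 2) / 2) (k + 1) u =
      gammaConst p (k + 1) * (zonalPoly a (k + 1)).eval u := by
  rw [← ha]
  rcases hp.eq_or_lt with rfl | hp2
  · obtain rfl : a = 0 := by rw [ha]; norm_num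
    have h := zonalPoly_zero_eval_cos k (Real.arccos u)
    rw [Real.cos_arccos hu.1 hu.2] at h
    rw [gegenbauer, if_pos rfl, h, gammaConst, if_pos rfl, if_neg (Nat.succ_ne_zero k)]
    ring
  · have hp' : (2 : ℝ) < p := by exact_mod_cast hp2
    have ha0 : 0 < a := by rw [ha]; linarith
    rw [gegenbauer, if_neg ha0.ne', gegenbauerRec_eq_zonalPoly ha0, gammaConst, if_neg hp2.ne']
    congr 1
    rw [show (p : ℝ) - 2 = 2 * a by rw [ha]; ring, add_sub_assoc,
      show (p : ℝ) - 2 = 2 * a by rw [ha]; ring, ← mul_add, mul_div_mul_left _ _ two_ne_zero]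

/-- The numerator carries `gammaConst` once and the denominator twice; the total mass and the value
at `1` cancel. The point `x` is an auxiliary pole through which the weighted integrals are compared
with the sphere. -/
lemma gegenbauerCoeff_eq (ha : a = ((p : ℝ) - 2) / 2) (hp : 2 ≤ p) [NeZero p] (hlam : 0 < lam)
    (x : UnitSphere p) (k : ℕ) :
    gegenbauerCoeff p lam (k + 1) = expCoeff a lam (k + 1) / gammaConst p (k + 1) := by
  have hp' : (2 : ℝ) ≤ p := by exact_mod_cast hp
  have ha0 : 0 ≤ a := by rw [ha]; linarith
  have hg := gammaConst_pos hp k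
  have hQ := zonalPoly_eval_one_pos ha0 (k + 1)
  have hμ := cosineIntegral_one_pos (p := p)
  rw [gegenbauerCoeff, weightedInner_eq_integral_cos hp, weightedInner_eq_integral_cos hp]
  simp only [gegenbauer_eq_zonalPoly ha hp k (Real.cos_mem_Icc _)]
  have e1 : ∫ θ in (0 : ℝ)..Real.pi, Real.exp (lam * Real.cos θ) *
      (gammaConst p (k + 1) * (zonalPoly a (k + 1)).eval (Real.cos θ)) * Real.sin θ ^ (p - 2) =
      gammaConst p (k + 1) * (cosineIntegral p 1 *
        (expCoeff a lam (k + 1) * (zonalPoly a (k + 1)).eval 1)) := by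
    rw [← integral_exp_mul_zonalPoly ha hp hlam x, ← intervalIntegral.integral_const_mul]
    congr 1 with θ
    ring
  have e2 : ∫ θ in (0 : ℝ)..Real.pi,
      gammaConst p (k + 1) * (zonalPoly a (k + 1)).eval (Real.cos θ) *
      (gammaConst p (k + 1) * (zonalPoly a (k + 1)).eval (Real.cos θ)) * Real.sin θ ^ (p - 2) =
      gammaConst p (k + 1) ^ 2 * (cosineIntegral p 1 * (zonalPoly a (k + 1)).eval 1) := by
    rw [← zonalForm_zonalPoly_self_diag ha hp x, ← cosineIntegral_mul hp x, cosineIntegral,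
      ← intervalIntegral.integral_const_mul]
    congr 1 with θ
    rw [Polynomial.eval_mul]
    ring
  rw [e1, e2]
  field_simp

lemma weight_eq (ha : a = ((p : ℝ) - 2) / 2) (hp : 2 ≤ p) [NeZero p] (hlam : 0 < lam)
    (x : UnitSphere p) (k : ℕ) :
    weight p lam (k + 1) =
      (expCoeff a lam (k + 1) * (((k + 1 : ℕ) : ℝ) * ((k + 1 : ℕ) + 2 * a))) ^ 2 /
        gammaConst p (k + 1) := by
  have hg := gammaConst_pos hp k
  rw [weight, gegenbauerCoeff_eq ha hp hlam x, show 2 * a = (p : ℝ) - 2 by rw [ha]; ring]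
  field_simp
  ring

lemma weight_eq_of_eq_two (hlam : 0 < lam) (x : UnitSphere 2) (k : ℕ) (hk : 1 ≤ k) :
    weight 2 lam k = 2 * (k : ℝ) ^ 4 * besselI (k : ℝ) lam ^ 2 := by
  obtain ⟨k, rfl⟩ := Nat.exists_eq_add_of_le' hk
  rw [weight_eq (a := 0) (by norm_num) le_rfl hlam x, expCoeff_eq_besselI le_rfl hlam, gammaConst,
    if_pos rfl, if_neg (Nat.succ_ne_zero k)]
  simp
  ring

lemma weight_eq_of_two_lt (hp : 2 < p) (hlam : 0 < lam) (x : UnitSphere p) (k : ℕ)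
    (hk : 1 ≤ k) :
    weight p lam k =
        (2 : ℝ) ^ ((p : ℤ) - 3) * lam ^ (2 - (p : ℤ)) * ((p : ℝ) - 2)
          * ((k : ℝ) + ((p : ℝ) - 2) / 2)
          * (Real.Gamma (((p : ℝ) - 2) / 2) * (k : ℝ) * ((k : ℝ) + (p : ℝ) - 2)
              * besselI (((p : ℝ) - 2) / 2 + (k : ℝ)) lam) ^ 2 := by
  have : NeZero p := ⟨by omega⟩
  obtain ⟨k, rfl⟩ := Nat.exists_eq_add_of_le' hk
  have hp' : (2 : ℝ) < p := by exact_mod_cast hp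
  set a : ℝ := ((p : ℝ) - 2) / 2 with ha
  have ha0 : 0 < a := by rw [ha]; linarith
  have hpa : (p : ℝ) - 2 = 2 * a := by rw [ha]; ring
  have hl2 : 0 < lam / 2 := by positivity
  have e1 : (((lam / 2) ^ a)⁻¹) ^ 2 = (2 : ℝ) ^ ((p : ℤ) - 2) * lam ^ (2 - (p : ℤ)) := by
    rw [inv_pow, ← Real.rpow_natCast, ← Real.rpow_mul hl2.le, ← Real.rpow_neg hl2.le,
      show -(a * (2 : ℕ)) = ((2 - (p : ℤ) : ℤ) : ℝ) by push_cast; linarith, Real.rpow_intCast,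
      div_zpow, div_eq_mul_inv, ← zpow_neg]
    rw [show -(2 - (p : ℤ)) = p - 2 by ring, mul_comm]
  -- From `Γ(a + 1) ^ 2 = a ^ 2 Γ(a) ^ 2` and `1 / gammaConst = (k + a) / a` there remains a factor
  -- `a = (p - 2) / 2`; its denominator absorbs this `2`.
  have e2 : (2 : ℝ) ^ ((p : ℤ) - 2) = 2 ^ ((p : ℤ) - 3) * 2 := by
    rw [show (p : ℤ) - 2 = p - 3 + 1 by ring, zpow_add_one₀ two_ne_zero]
  have hka : (0 : ℝ) < ((k + 1 : ℕ) : ℝ) + a := by positivity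
  have e3 : gammaConst p (k + 1) = a / ((k + 1 : ℕ) + a) := by
    rw [gammaConst, if_neg hp.ne', add_sub_assoc, hpa, ← mul_add,
      mul_div_mul_left _ _ two_ne_zero]
  rw [weight_eq ha hp.le hlam x, expCoeff_eq_besselI ha0.le hlam, Real.Gamma_add_one ha0.ne', e3,
    add_sub_assoc, hpa]
  simp only [mul_pow]
  rw [e1, e2]
  field_simp

end WeightedIntegral

/-! ### The spherical Laplacian of the exponential. -/

section SphericalLaplacian

/-- The second Fréchet derivative along a direction, from the derivatives along a line. -/
lemma iteratedFDeriv_two_eq_of_hasDerivAt {E : Type*} [NormedAddCommGroup E] [NormedSpace ℝ E]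
    {g : E → ℝ} {x v : E} (hg : ContDiffAt ℝ 2 g x) {ψ : ℝ → ℝ} {c : ℝ}
    (h1 : ∀ᶠ s in nhds (0 : ℝ), HasDerivAt (fun s : ℝ => g (x + s • v)) (ψ s) s)
    (h2 : HasDerivAt ψ c 0) : iteratedFDeriv ℝ 2 g x ![v, v] = c := by
  have hline : ∀ s : ℝ, HasDerivAt (fun s : ℝ => x + s • v) v s := fun s => by
    simpa using ((hasDerivAt_id' s).smul_const v).const_add x
  have htend : Filter.Tendsto (fun s : ℝ => x + s • v) (nhds 0) (nhds x) := by
    simpa using (hline 0).continuousAt.tendsto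
  have hd : ∀ᶠ s in nhds (0 : ℝ), ψ s = fderiv ℝ g (x + s • v) v := by
    have hdiff := (hg.eventually (by simp)).mono fun y hy => hy.differentiableAt (by simp)
    filter_upwards [h1, htend.eventually hdiff] with s hs hs'
    exact hs.unique (hs'.hasFDerivAt.comp_hasDerivAt s (hline s))
  have h3 : HasFDerivAt (fderiv ℝ g) (fderiv ℝ (fderiv ℝ g) x) (x + (0 : ℝ) • v) := by
    rw [zero_smul, add_zero]
    exact ((hg.fderiv_right (m := 1) (by norm_num)).differentiableAt (by simp)).hasFDerivAt
  have h4 : HasDerivAt (fun s : ℝ => fderiv ℝ g (x + s • v)) (fderiv ℝ (fderiv ℝ g) x v) 0 :=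
    h3.comp_hasDerivAt (0 : ℝ) (hline 0)
  have h5 : HasDerivAt (fun s : ℝ => fderiv ℝ g (x + s • v) v)
      (fderiv ℝ (fderiv ℝ g) x v v) 0 := by
    simpa using h4.clm_apply (hasDerivAt_const (0 : ℝ) v)
  rw [iteratedFDeriv_two_apply]
  exact (h5.congr_of_eventuallyEq hd).unique h2

variable {p : ℕ}

/-- A one-variable computation along `x + s v`: the inverse norm satisfies `r' = -(ξ + s) r ^ 3`, so
the second derivative follows from the product rule. -/
lemma iteratedFDeriv_two_exp_inner_div_norm (lam : ℝ) (t x : UnitSphere p)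
    {v : EuclideanSpace ℝ (Fin p)} (hv : ‖v‖ = 1) :
    iteratedFDeriv ℝ 2 (fun y : EuclideanSpace ℝ (Fin p) =>
      Real.exp (lam * (‖y‖⁻¹ * inner ℝ (t : EuclideanSpace ℝ (Fin p)) y))) x ![v, v] =
    Real.exp (lam * inner ℝ (t : EuclideanSpace ℝ (Fin p)) (x : EuclideanSpace ℝ (Fin p))) *
      (lam ^ 2 * (inner ℝ (t : EuclideanSpace ℝ (Fin p)) v -
        inner ℝ (t : EuclideanSpace ℝ (Fin p)) (x : EuclideanSpace ℝ (Fin p)) *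
          inner ℝ (x : EuclideanSpace ℝ (Fin p)) v) ^ 2 +
      lam * (inner ℝ (t : EuclideanSpace ℝ (Fin p)) (x : EuclideanSpace ℝ (Fin p)) *
          (3 * inner ℝ (x : EuclideanSpace ℝ (Fin p)) v ^ 2 - 1) -
        2 * inner ℝ (t : EuclideanSpace ℝ (Fin p)) v *
          inner ℝ (x : EuclideanSpace ℝ (Fin p)) v)) := by
  have hx : ‖(x : EuclideanSpace ℝ (Fin p))‖ = 1 := norm_eq_of_mem_sphere x
  have hx0 : (x : EuclideanSpace ℝ (Fin p)) ≠ 0 := by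
    intro h; rw [h, norm_zero] at hx; exact zero_ne_one hx
  set u := inner ℝ (t : EuclideanSpace ℝ (Fin p)) (x : EuclideanSpace ℝ (Fin p))
  set τ := inner ℝ (t : EuclideanSpace ℝ (Fin p)) v
  set ξ := inner ℝ (x : EuclideanSpace ℝ (Fin p)) v with hξ
  have hg : ContDiffAt ℝ 2 (fun y : EuclideanSpace ℝ (Fin p) =>
      Real.exp (lam * (‖y‖⁻¹ * inner ℝ (t : EuclideanSpace ℝ (Fin p)) y))) x :=
    (contDiffAt_const.mul (((contDiffAt_norm ℝ hx0).inv (norm_ne_zero_iff.2 hx0)).mul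
      (contDiffAt_const.inner ℝ contDiffAt_id))).exp
  set r : ℝ → ℝ := fun s => (√(1 + 2 * s * ξ + s ^ 2))⁻¹ with hr
  have hr0 : r 0 = 1 := by simp [hr]
  have hnorm : ∀ s : ℝ, ‖(x : EuclideanSpace ℝ (Fin p)) + s • v‖⁻¹ = r s := by
    intro s
    rw [hr, ← Real.sqrt_sq (norm_nonneg ((x : EuclideanSpace ℝ (Fin p)) + s • v)),
      norm_add_sq_real, norm_smul, real_inner_smul_right, hx, hv, ← hξ]
    simp only [Real.norm_eq_abs, mul_one, sq_abs, one_pow]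
    congr 3
    ring
  have hrd : ∀ s : ℝ, 0 < 1 + 2 * s * ξ + s ^ 2 → HasDerivAt r (-(ξ + s) * r s ^ 3) s := by
    intro s hs
    have hN : HasDerivAt (fun s : ℝ => 1 + 2 * s * ξ + s ^ 2) (2 * ξ + 2 * s) s := by
      have h := ((((hasDerivAt_id' s).const_mul 2).mul_const ξ).const_add 1).fun_add
        ((hasDerivAt_id' s).fun_pow 2)
      refine h.congr_deriv ?_
      simp
    have hsq := Real.sqrt_pos.2 hs
    refine ((hN.sqrt hs.ne').inv hsq.ne').congr_deriv ?_
    simp only [hr]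
    field_simp
  have hev : ∀ᶠ s in nhds (0 : ℝ), 0 < 1 + 2 * s * ξ + s ^ 2 := by
    have hc : Continuous fun s : ℝ => 1 + 2 * s * ξ + s ^ 2 := by fun_prop
    exact hc.continuousAt.eventually_const_lt (by simp)
  have hlin : ∀ s : ℝ, HasDerivAt (fun s : ℝ => u + s * τ) τ s := fun s => by
    simpa using ((hasDerivAt_id' s).mul_const τ).const_add u
  have hφ : ∀ s : ℝ, 0 < 1 + 2 * s * ξ + s ^ 2 →
      HasDerivAt (fun s : ℝ => Real.exp (lam * (r s * (u + s * τ))))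
        (Real.exp (lam * (r s * (u + s * τ))) *
          (lam * (-(ξ + s) * r s ^ 3 * (u + s * τ) + r s * τ))) s := fun s hs =>
    (((hrd s hs).fun_mul (hlin s)).const_mul lam).exp
  have h0 : (0 : ℝ) < 1 + 2 * 0 * ξ + 0 ^ 2 := by simp
  refine iteratedFDeriv_two_eq_of_hasDerivAt hg
    (ψ := fun s => Real.exp (lam * (r s * (u + s * τ))) *
          (lam * (-(ξ + s) * r s ^ 3 * (u + s * τ) + r s * τ))) ?_ ?_
  · filter_upwards [hev] with s hs
    simp only [hnorm, inner_add_right, real_inner_smul_right]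
    exact hφ s hs
  · have hξs : HasDerivAt (fun s : ℝ => -(ξ + s)) (-1) 0 :=
      ((hasDerivAt_id' (0 : ℝ)).const_add ξ).fun_neg
    have h := (hφ 0 h0).fun_mul ((((hξs.fun_mul ((hrd 0 h0).fun_pow 3)).fun_mul (hlin 0)).fun_add
      ((hrd 0 h0).mul_const τ)).const_mul lam)
    refine h.congr_deriv ?_
    simp only [hr0]
    simp
    ring

/-- The spherical Laplacian of `x ↦ exp (lam tᵀx)`. -/
lemma steinExp_eq_steinProfile {a : ℝ} (ha : a = ((p : ℝ) - 2) / 2) (lam : ℝ)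
    (t x : UnitSphere p) :
    steinExp lam t x = steinProfile a lam
      (inner ℝ (t : EuclideanSpace ℝ (Fin p)) (x : EuclideanSpace ℝ (Fin p))) := by
  have hx : ‖(x : EuclideanSpace ℝ (Fin p))‖ = 1 := norm_eq_of_mem_sphere x
  have ht : ‖(t : EuclideanSpace ℝ (Fin p))‖ = 1 := norm_eq_of_mem_sphere t
  have hx0 : (x : EuclideanSpace ℝ (Fin p)) ≠ 0 := by
    intro h; rw [h, norm_zero] at hx; exact zero_ne_one hx
  have hext : radialExtension (fun y : UnitSphere p =>
      Real.exp (lam * inner ℝ (t : EuclideanSpace ℝ (Fin p)) (y : EuclideanSpace ℝ (Fin p))))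
      =ᶠ[nhds (x : EuclideanSpace ℝ (Fin p))] fun y : EuclideanSpace ℝ (Fin p) =>
      Real.exp (lam * (‖y‖⁻¹ * inner ℝ (t : EuclideanSpace ℝ (Fin p)) y)) := by
    filter_upwards [isOpen_ne.mem_nhds hx0] with y hy
    rw [radialExtension, dif_neg hy, real_inner_smul_right]
  rw [steinExp, laplaceBeltrami, (InnerProductSpace.laplacian_congr_nhds hext).eq_of_nhds,
    InnerProductSpace.laplacian_eq_iteratedFDeriv_orthonormalBasis _
      (EuclideanSpace.basisFun (Fin p) ℝ)]
  simp only [iteratedFDeriv_two_exp_inner_div_norm lam t x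
    ((EuclideanSpace.basisFun (Fin p) ℝ).orthonormal.1 _)]
  rw [← Finset.mul_sum, Finset.sum_add_distrib, ← Finset.mul_sum, ← Finset.mul_sum]
  set u := inner ℝ (t : EuclideanSpace ℝ (Fin p)) (x : EuclideanSpace ℝ (Fin p)) with hu
  have hs : ∀ v w : EuclideanSpace ℝ (Fin p),
      ∑ i, inner ℝ v (EuclideanSpace.basisFun (Fin p) ℝ i) *
        inner ℝ w (EuclideanSpace.basisFun (Fin p) ℝ i) = inner ℝ v w := by
    intro v w
    rw [← (EuclideanSpace.basisFun (Fin p) ℝ).sum_inner_mul_inner v w]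
    simp only [real_inner_comm w]
  have htt := hs t t
  have hxx := hs x x
  have htx := hs t x
  rw [real_inner_self_eq_norm_sq, ht] at htt
  rw [real_inner_self_eq_norm_sq, hx] at hxx
  -- By Parseval this is the squared length of the component of `t` orthogonal to `x`.
  have e1 : ∑ i, (inner ℝ (t : EuclideanSpace ℝ (Fin p)) (EuclideanSpace.basisFun (Fin p) ℝ i) -
      u * inner ℝ (x : EuclideanSpace ℝ (Fin p)) (EuclideanSpace.basisFun (Fin p) ℝ i)) ^ 2 =
      1 - u ^ 2 := by
    have : ∀ i, (inner ℝ (t : EuclideanSpace ℝ (Fin p)) (EuclideanSpace.basisFun (Fin p) ℝ i) -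
      u * inner ℝ (x : EuclideanSpace ℝ (Fin p)) (EuclideanSpace.basisFun (Fin p) ℝ i)) ^ 2 =
      inner ℝ (t : EuclideanSpace ℝ (Fin p)) (EuclideanSpace.basisFun (Fin p) ℝ i) *
        inner ℝ (t : EuclideanSpace ℝ (Fin p)) (EuclideanSpace.basisFun (Fin p) ℝ i) -
      2 * u * (inner ℝ (t : EuclideanSpace ℝ (Fin p)) (EuclideanSpace.basisFun (Fin p) ℝ i) *
        inner ℝ (x : EuclideanSpace ℝ (Fin p)) (EuclideanSpace.basisFun (Fin p) ℝ i)) +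
      u ^ 2 * (inner ℝ (x : EuclideanSpace ℝ (Fin p)) (EuclideanSpace.basisFun (Fin p) ℝ i) *
        inner ℝ (x : EuclideanSpace ℝ (Fin p)) (EuclideanSpace.basisFun (Fin p) ℝ i)) :=
      fun i => by ring
    rw [Finset.sum_congr rfl fun i _ => this i, Finset.sum_add_distrib, Finset.sum_sub_distrib,
      ← Finset.mul_sum, ← Finset.mul_sum, htt, hxx, htx, ← hu]
    ring
  -- The trace of the first-order part: `u (3 - p) - 2 u`.
  have e2 : ∑ i, (u * (3 * inner ℝ (x : EuclideanSpace ℝ (Fin p))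
      (EuclideanSpace.basisFun (Fin p) ℝ i) ^ 2 - 1) -
      2 * inner ℝ (t : EuclideanSpace ℝ (Fin p)) (EuclideanSpace.basisFun (Fin p) ℝ i) *
        inner ℝ (x : EuclideanSpace ℝ (Fin p)) (EuclideanSpace.basisFun (Fin p) ℝ i)) =
      u * (1 - p) := by
    have : ∀ i, u * (3 * inner ℝ (x : EuclideanSpace ℝ (Fin p))
      (EuclideanSpace.basisFun (Fin p) ℝ i) ^ 2 - 1) -
      2 * inner ℝ (t : EuclideanSpace ℝ (Fin p)) (EuclideanSpace.basisFun (Fin p) ℝ i) *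
        inner ℝ (x : EuclideanSpace ℝ (Fin p)) (EuclideanSpace.basisFun (Fin p) ℝ i) =
      3 * u * (inner ℝ (x : EuclideanSpace ℝ (Fin p)) (EuclideanSpace.basisFun (Fin p) ℝ i) *
        inner ℝ (x : EuclideanSpace ℝ (Fin p)) (EuclideanSpace.basisFun (Fin p) ℝ i)) -
      2 * (inner ℝ (t : EuclideanSpace ℝ (Fin p)) (EuclideanSpace.basisFun (Fin p) ℝ i) *
        inner ℝ (x : EuclideanSpace ℝ (Fin p)) (EuclideanSpace.basisFun (Fin p) ℝ i)) - u :=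
      fun i => by ring
    rw [Finset.sum_congr rfl fun i _ => this i, Finset.sum_sub_distrib, Finset.sum_sub_distrib,
      ← Finset.mul_sum, ← Finset.mul_sum, hxx, htx, ← hu]
    simp
    ring
  rw [e1, e2, steinProfile, ha]
  ring

end SphericalLaplacian

/-! ### Assembly: expansion of the test statistic. -/

section TestStatistic

variable {p n : ℕ} {a lam : ℝ}

lemma empiricalStein_eq (ha : a = ((p : ℝ) - 2) / 2) (lam : ℝ) (X : Fin n → UnitSphere p) :
    empiricalStein lam X = fun t : UnitSphere p => (1 / (n : ℝ)) * ∑ j, steinProfile a lam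
      (inner ℝ (t : EuclideanSpace ℝ (Fin p)) (X j : EuclideanSpace ℝ (Fin p))) := by
  funext t
  simp only [empiricalStein, steinExp_eq_steinProfile ha]

lemma continuous_steinProfile_inner (x : UnitSphere p) :
    Continuous fun t : UnitSphere p => steinProfile a lam
      (inner ℝ (t : EuclideanSpace ℝ (Fin p)) (x : EuclideanSpace ℝ (Fin p))) :=
  continuous_steinProfile.comp (by fun_prop)

variable [NeZero p]

lemma memLp_empiricalStein (X : Fin n → UnitSphere p) :
    MemLp (empiricalStein lam X) 2 (uniformSphere p) := by
  rw [empiricalStein_eq rfl]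
  refine Continuous.memLp_of_hasCompactSupport ?_ (HasCompactSupport.of_compactSpace _)
  exact continuous_const.mul (continuous_finsetSum _ fun j _ => continuous_steinProfile_inner (X j))

lemma testStatistic_eq (ha : a = ((p : ℝ) - 2) / 2) (hn : 1 ≤ n) (X : Fin n → UnitSphere p) :
    testStatistic lam X = (1 / (n : ℝ)) * ∑ i : Fin n, ∑ j : Fin n, ∫ t : UnitSphere p,
      steinProfile a lam
        (inner ℝ (t : EuclideanSpace ℝ (Fin p)) (X i : EuclideanSpace ℝ (Fin p))) *
      steinProfile a lam
        (inner ℝ (t : EuclideanSpace ℝ (Fin p)) (X j : EuclideanSpace ℝ (Fin p)))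
      ∂(uniformSphere p) := by
  have hn0 : (n : ℝ) ≠ 0 := by exact_mod_cast (by omega : n ≠ 0)
  rw [testStatistic, empiricalStein_eq ha]
  simp only [mul_pow, sq (Finset.sum _ _), Finset.sum_mul_sum]
  rw [integral_const_mul, integral_finsetSum]
  · rw [Finset.sum_congr rfl fun i _ => integral_finsetSum _ fun j _ => ?_]
    · field_simp
    · exact integrable_uniformSphere_of_continuous
        ((continuous_steinProfile_inner _).mul (continuous_steinProfile_inner _))
  · intro i _
    exact integrable_uniformSphere_of_continuous (continuous_finsetSum _ fun j _ =>
      (continuous_steinProfile_inner _).mul (continuous_steinProfile_inner _))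

/-- The term of degree `0` vanishes because of its eigenvalue, hence the shift. The factor
`gammaConst` of the Gegenbauer polynomial cancels the one in the denominator of the weight. -/
lemma hasSum_weight_mul_gegenbauer (ha : a = ((p : ℝ) - 2) / 2) (hp : 2 ≤ p) (hlam : 0 < lam)
    (x y : UnitSphere p) :
    HasSum (fun k : ℕ => weight p lam (k + 1) * gegenbauer (((p : ℝ) - 2) / 2) (k + 1)
        (inner ℝ (x : EuclideanSpace ℝ (Fin p)) (y : EuclideanSpace ℝ (Fin p))))
      (∫ t : UnitSphere p, steinProfile a lam
        (inner ℝ (t : EuclideanSpace ℝ (Fin p)) (x : EuclideanSpace ℝ (Fin p))) *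
        steinProfile a lam
        (inner ℝ (t : EuclideanSpace ℝ (Fin p)) (y : EuclideanSpace ℝ (Fin p)))
        ∂(uniformSphere p)) := by
  have h := (hasSum_nat_add_iff' 1).2
    (hasSum_integral_steinProfile_mul_steinProfile ha hp hlam x y)
  simp only [Finset.sum_range_one, Nat.cast_zero, zero_mul, mul_zero, ne_eq, OfNat.ofNat_ne_zero,
    not_false_eq_true, zero_pow, sub_zero] at h
  refine h.congr_fun fun k => ?_
  have hu : inner ℝ (x : EuclideanSpace ℝ (Fin p)) (y : EuclideanSpace ℝ (Fin p)) ∈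
      Set.Icc (-1 : ℝ) 1 := by
    have := abs_inner_sphere_le (x : EuclideanSpace ℝ (Fin p)) y
    rw [norm_eq_of_mem_sphere] at this
    exact abs_le.1 this
  have hg := gammaConst_pos hp k
  rw [gegenbauer_eq_zonalPoly ha hp k hu, weight_eq ha hp hlam x]
  field_simp

end TestStatistic

theorem lemma1 (p n : ℕ) (hp : 2 ≤ p) (hn : 1 ≤ n) (lam : ℝ) (hlam : 0 < lam)
    (X : Fin n → UnitSphere p) :
    MeasureTheory.MemLp (empiricalStein lam X) 2 (uniformSphere p) ∧
    (∀ i j : Fin n, Summable fun k : ℕ =>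
      weight p lam (k + 1) * gegenbauer (((p : ℝ) - 2) / 2) (k + 1)
        (inner ℝ (X i : EuclideanSpace ℝ (Fin p)) (X j : EuclideanSpace ℝ (Fin p)))) ∧
    testStatistic lam X = (1 / (n : ℝ)) * ∑ i : Fin n, ∑ j : Fin n, ∑' k : ℕ,
      weight p lam (k + 1) * gegenbauer (((p : ℝ) - 2) / 2) (k + 1)
        (inner ℝ (X i : EuclideanSpace ℝ (Fin p)) (X j : EuclideanSpace ℝ (Fin p))) ∧
    (p = 2 → ∀ k : ℕ, 1 ≤ k →
      weight p lam k = 2 * (k : ℝ) ^ 4 * besselI (k : ℝ) lam ^ 2) ∧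
    (2 < p → ∀ k : ℕ, 1 ≤ k →
      weight p lam k =
        (2 : ℝ) ^ ((p : ℤ) - 3) * lam ^ (2 - (p : ℤ)) * ((p : ℝ) - 2)
          * ((k : ℝ) + ((p : ℝ) - 2) / 2)
          * (Real.Gamma (((p : ℝ) - 2) / 2) * (k : ℝ) * ((k : ℝ) + (p : ℝ) - 2)
              * besselI (((p : ℝ) - 2) / 2 + (k : ℝ)) lam) ^ 2) := by
  have : NeZero p := ⟨by omega⟩
  have hsum := hasSum_weight_mul_gegenbauer (p := p) rfl hp hlam
  refine ⟨memLp_empiricalStein X, fun i j => (hsum (X i) (X j)).summable, ?_, ?_, ?_⟩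
  · rw [testStatistic_eq rfl hn]
    simp only [fun i j => (hsum (X i) (X j)).tsum_eq]
  · rintro rfl k hk
    -- The first sample point serves as the auxiliary pole on the sphere.
    exact weight_eq_of_eq_two hlam (X ⟨0, hn⟩) k hk
  · exact fun hp2 k hk => weight_eq_of_two_lt hp2 hlam (X ⟨0, hn⟩) k hk
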